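/- Let $\mu\ge 2$. For measurable $u:\mathbb R^3\to\mathbb C$ put $\|u\|_\mu=\operatorname{ess\,sup}_{p\in\mathbb R^3}(1+|p|)^\mu|u(p)|$ and $L^\infty_\mu(\mathbb R^3)=\{u\in L^\infty(\mathbb R^3):\|u\|_\mu<\infty\}$. Let $\Sigma=\{k\in\mathbb C^3: k^2=0\}$, where $k^2=k_1^2+k_2^2+k_3^2$, and for $\tau>0$ let $\Sigma^\tau=\{k\in\Sigma:|\operatorname{Im}k|<\tau\}$. For $\hat v,U\in L^\infty_\mu(\mathbb R^3)$ and $k\in\Sigma$ put $$(A(k)U)(p)=\int_{\mathbb R^3}\frac{\hat v(p+\xi)\,U(-\xi)}{\xi^2+2k\xi}\,d\xi,\qquad p\in\mathbb R^3,\qquad k\xi=k_1\xi_1+k_2\xi_2+k_3\xi_3 .$$ This integral converges absolutely for every $p$, and there are constants $c_1=c_1(\mu)>0$ and $c_2=c_2(\mu)>0$, depending only on $\mu$, such that for all $\hat v,U\in L^\infty_\mu(\mathbb R^3)$ and $k\in\Sigma$ $$\|A(k)U\|_\mu\le c_1\|\hat v\|_\mu\|U\|_\mu,\qquad \|A(k)U\|_\mu\le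 c_2\frac{(\ln|\operatorname{Im}k|)^2}{|\operatorname{Im}k|}\|\hat v\|_\mu\|U\|_\mu\ \text{ if }\ \ln|\operatorname{Im}k|\ge 2,$$ and such that the following holds for every $\hat v\in L^\infty_\mu(\mathbb R^3)$ and every $C\ge 0$ with $\|\hat v\|_\mu\le C$. Consider, for fixed $k\in\Sigma$, the Faddeev equation $$H(k,p)=\hat v(p)-\int_{\mathbb R^3}\frac{\hat v(p+\xi)H(k,-\xi)}{\xi^2+2k\xi}\,d\xi,\qquad p\in\mathbb R^3,\tag{F}$$ for $H(k,\cdot)\in L^\infty_\mu(\mathbb R^3)$. (I) If $c_1C<1$, then for every $k\in\Sigma$ equation (F) is uniquely solvable for $H(k,\cdot)\in L^\infty_\mu(\mathbb R^3)$ by the method of successive approximations (the iterates $U_{n+1}=\hat v-A(k)U_n$ lie in $L^\infty_\mu(\mathbb R^3)$ and $\|U_n-H(k,\cdot)\|_\mu\to 0$ for every $U_0\in L^\infty_\mu(\mathbb R^3)$), and $$\|H(k,\cdot)\|_\mu\le\frac{C}{1-c_1C}\quad(k\in\Sigma),\qquad H-\hat v\in\mathcal C(\Sigma\times\mathbb R^3),$$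 $$|H(k,p)-\hat v(p)|\le\frac{c_1C^2}{(1-c_1C)(1+|p|)^\mu},\qquad k\in\Sigma,\ p\in\mathbb R^3 .$$ (II) Put $\eta_2(C,t)=c_2C(\ln t)^2/t$ for $t>0$. If $\tau>0$, $\ln\tau\ge 2$ and $\eta_2(C,\tau)<1$, then for every $k\in\Sigma\setminus\Sigma^\tau$ equation (F) is uniquely solvable for $H(k,\cdot)\in L^\infty_\mu(\mathbb R^3)$ by the method of successive approximations (in the same sense), and $$\|H(k,\cdot)\|_\mu\le\frac{C}{1-\eta_2(C,|\operatorname{Im}k|)}\quad(k\in\Sigma\setminus\Sigma^\tau),\qquad H-\hat v\in\mathcal C((\Sigma\setminus\Sigma^\tau)\times\mathbb R^3),$$ $$|H(k,p)-\hat v(p)|\le\frac{\eta_2(C,|\operatorname{Im}k|)\,C}{(1-\eta_2(C,|\operatorname{Im}k|))(1+|p|)^\mu},\qquad k\in\Sigma\setminus\Sigma^\tau,\ p\in\mathbb R^3 .$$ Here $H(k,\cdot)$ is taken in the representative for which (F) holds at every $p\in\mathbb R^3$, with the given representative of $\hat v$; uniqueness is up to equality almost everywhere. -/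

import Mathlib

open MeasureTheory Filter Topology

noncomputable section

/-- `ℝ³` with its Euclidean norm and Lebesgue measure. -/
abbrev R3 : Type := EuclideanSpace ℝ (Fin 3)

/-- `ℂ³`. -/
abbrev C3 : Type := EuclideanSpace ℂ (Fin 3)

/-- The weighted norm `‖u‖_μ = ess sup_p (1 + |p|)^μ |u(p)|`, with values in `[0, ∞]`. -/
def lmuNorm (μ : ℝ) (u : R3 → ℂ) : ENNReal :=
  essSup (fun p => ENNReal.ofReal ((1 + ‖p‖) ^ μ * ‖u p‖)) volume

/-- `u` is (a representative of) an element of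
`L^∞_μ(ℝ³) = {u ∈ L^∞(ℝ³) : ‖u‖_μ < ∞}`. -/
def MemLmu (μ : ℝ) (u : R3 → ℂ) : Prop :=
  MemLp u ⊤ volume ∧ lmuNorm μ u < ⊤

/-- The bilinear (not Hermitian) product `k ξ = k₁ ξ₁ + k₂ ξ₂ + k₃ ξ₃` of `k ∈ ℂ³`, `ξ ∈ ℝ³`. -/
def bilin (k : C3) (ξ : R3) : ℂ := ∑ j, k j * (ξ j : ℂ)

/-- The complex cone `Σ = {k ∈ ℂ³ : k² = 0}`, where `k² = k₁² + k₂² + k₃²`. -/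
def sigmaSet : Set C3 := {k | ∑ j, k j ^ 2 = 0}

/-- The vector `Im k ∈ ℝ³` of `k ∈ ℂ³`. -/
def imVec (k : C3) : R3 := WithLp.toLp 2 (fun j => (k j).im)

/-- `Σ^τ = {k ∈ Σ : |Im k| < τ}`. -/
def sigmaBelow (τ : ℝ) : Set C3 := {k | k ∈ sigmaSet ∧ ‖imVec k‖ < τ}

/-- The integrand `v̂(p + ξ) U(-ξ) / (ξ² + 2 k ξ)`, as a function of `ξ`. -/
def faddeevIntegrand (vhat : R3 → ℂ) (k : C3) (U : R3 → ℂ) (p ξ : R3) : ℂ :=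
  vhat (p + ξ) * U (-ξ) / ((‖ξ‖ ^ 2 : ℝ) + 2 * bilin k ξ)

/-- The operator `(A(k)U)(p) = ∫ v̂(p + ξ) U(-ξ) / (ξ² + 2 k ξ) dξ`. -/
def faddeevOp (vhat : R3 → ℂ) (k : C3) (U : R3 → ℂ) (p : R3) : ℂ :=
  ∫ ξ : R3, faddeevIntegrand vhat k U p ξ

/-- One step `U ↦ v̂ - A(k)U` of the method of successive approximations. -/
def faddeevStep (vhat : R3 → ℂ) (k : C3) (U : R3 → ℂ) : R3 → ℂ :=
  fun p => vhat p - faddeevOp vhat k U p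

/-- For every `k ∈ S`, the integral equation
`H(k,p) = v̂(p) - ∫ v̂(p + ξ) H(k,-ξ) / (ξ² + 2 k ξ) dξ`
is uniquely solvable in `L^∞_μ(ℝ³)`, the solution being `H(k,·)`, and the method of successive
approximations converges to `H(k,·)` in the norm of `L^∞_μ(ℝ³)`. -/
structure UniquelySolvedBy (μ : ℝ) (vhat : R3 → ℂ) (S : Set C3) (H : C3 → R3 → ℂ) : Prop where
  mem : ∀ k ∈ S, MemLmu μ (H k)
  /-- `H(k,·)` solves the equation, for every `p` (not only almost every `p`). -/
  solves : ∀ k ∈ S, ∀ p, H k p = vhat p - faddeevOp vhat k (H k) p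
  /-- Any solution in `L^∞_μ(ℝ³)` of the equation between classes of functions modulo equality
  almost everywhere is `H(k,·)`. -/
  unique : ∀ k ∈ S, ∀ U : R3 → ℂ, MemLmu μ U →
    (∀ᵐ p, U p = vhat p - faddeevOp vhat k U p) → U =ᵐ[volume] H k
  /-- Successive approximations, from any starting point in `L^∞_μ(ℝ³)`. -/
  successive : ∀ k ∈ S, ∀ U₀ : R3 → ℂ, MemLmu μ U₀ →
    (∀ n : ℕ, MemLmu μ ((faddeevStep vhat k)^[n] U₀)) ∧
    Tendsto (fun n : ℕ => lmuNorm μ (fun p => (faddeevStep vhat k)^[n] U₀ p - H k p))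
      atTop (𝓝 0)

/-- `η₂ = c₂ C (ln t)² / t`, where `c` stands for the constant `c₂(μ)`. -/
def eta2 (c C t : ℝ) : ℝ := c * C * (Real.log t ^ 2 / t)

end

/-!
The denominator of the Faddeev kernel is controlled by an averaging identity. Write `k = a + i b`
with `k² = 0`, so that `a ⊥ b` and `|a| = |b| = t`, let `x = ξ + a`, and let `u(θ)` run over the
circle of radius `t` about the origin in the plane orthogonal to `b`. Then `ξ² + 2 k ξ` vanishes
exactly when `x` lies on the circle, `|x - u(θ)|² = M - N cos (θ - φ)` with
`M² - N² = |ξ² + 2 k ξ|²`, and therefore `1 / |ξ² + 2 k ξ|` is the mean over `θ` of the Riesz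
kernel `|x - u(θ)|⁻²`. Only the upper bound up to a constant is needed
(`enorm_inv_le_lintegral_circlePt`).

By Tonelli, integrals of `1 / |ξ² + 2 k ξ|` become averages of integrals of the Riesz kernel. The
convolution of `(1 + |·|)⁻²` with `|·|⁻²` is `O(1 / (1 + |·|))`
(`lintegral_sqWeight_mul_inv_sq_le`), and the mean over the circle of `1 / (1 + |y - u(θ)|)` is
bounded, and at most of order `log (1 + t) / t` (`lintegral_inv_one_add_sin_le`). Since the
larger of `1 + |p + ξ|` and `1 + |ξ|` is at least `(1 + |p|) / 2`, this gives both operator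
estimates for `A(k)` (`exists_kernelBound`).

Under the smallness conditions `U ↦ v̂ - A(k) U` is a contraction, with bounds at every `p`, so the
iterates converge pointwise everywhere and geometrically to a solution `faddeevSol`. For the joint
continuity of `H - v̂` in `(k, p)` the same averaging shows that the part of the integral near the
zeros of the denominator is small uniformly in `k`; with a truncated denominator, continuity follows
from the continuity of translations in `L²` and dominated convergence
(`continuousOn_faddeevOp`). It passes to `H - v̂` by uniform convergence of the iterates.
-/

open scoped RealInnerProductSpace

/-! ### The denominator as a circular mean of Riesz kernels -/

/-- The denominator `ξ² + 2 k ξ` of the Faddeev kernel. -/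
noncomputable def denom (k : C3) (ξ : R3) : ℂ := (‖ξ‖ ^ 2 : ℝ) + 2 * bilin k ξ

/-- The point with parameter `θ` of the circle spanned by the orthogonal vectors `a` and `c`. -/
noncomputable def circlePt (a c : R3) (θ : ℝ) : R3 := Real.cos θ • a + Real.sin θ • c

theorem continuous_circlePt (a c : R3) : Continuous (circlePt a c) := by
  unfold circlePt; fun_prop

/-- Two orthogonal vectors of equal length in `ℝ³` are completed by a rescaled cross product to an
orthogonal system of three vectors of that length; the last clause is Parseval's identity. -/
theorem exists_orthogonal_completion (a b : R3) (hab : ‖a‖ = ‖b‖) (h0 : ⟪a, b⟫ = 0) :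
    ∃ c : R3, ‖c‖ = ‖b‖ ∧ ⟪a, c⟫ = 0 ∧
      ∀ x : R3, ‖b‖ ^ 2 * ‖x‖ ^ 2 = ⟪x, a⟫ ^ 2 + ⟪x, b⟫ ^ 2 + ⟪x, c⟫ ^ 2 := by
  rcases eq_or_ne b 0 with rfl | hb
  · have ha : a = 0 := by simpa using hab
    subst ha
    exact ⟨0, by simp, by simp, fun x => by simp⟩
  have ht : ‖b‖ ≠ 0 := by simpa using hb
  have hA : ‖a‖ ^ 2 = ‖b‖ ^ 2 := by rw [hab]
  have hB : ‖b‖ ^ 2 = ‖b‖ ^ 2 := rfl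
  set t := ‖b‖ with htdef
  have htpos : 0 < t := norm_pos_iff.mpr hb
  conv_lhs at hB => rw [htdef]
  simp only [EuclideanSpace.real_norm_sq_eq, Fin.sum_univ_three] at hA hB
  simp only [PiLp.inner_apply, Fin.sum_univ_three, RCLike.inner_apply, conj_trivial] at h0
  refine ⟨WithLp.toLp 2 ![t⁻¹ * (a 1 * b 2 - a 2 * b 1), t⁻¹ * (a 2 * b 0 - a 0 * b 2),
    t⁻¹ * (a 0 * b 1 - a 1 * b 0)], ?_, ?_, fun x => ?_⟩
  · rw [← sq_eq_sq₀ (norm_nonneg _) htpos.le]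
    simp only [EuclideanSpace.real_norm_sq_eq, Fin.sum_univ_three]
    simp
    field_simp
    linear_combination (b 0 ^ 2 + b 1 ^ 2 + b 2 ^ 2) * hA + t ^ 2 * hB -
      (b 0 * a 0 + b 1 * a 1 + b 2 * a 2) * h0
  · simp only [PiLp.inner_apply, Fin.sum_univ_three, RCLike.inner_apply, conj_trivial]
    simp
    field_simp
    ring
  · simp only [PiLp.inner_apply, Fin.sum_univ_three, RCLike.inner_apply, conj_trivial,
      EuclideanSpace.real_norm_sq_eq]
    simp
    field_simp
    have e : (b 0 * a 0 + b 1 * a 1 + b 2 * a 2) = 0 := h0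
    -- the Gram determinant of `x`, `a`, `b`
    have gram : (x 0 * (a 1 * b 2 - a 2 * b 1) + x 1 * (a 2 * b 0 - a 0 * b 2)
        + x 2 * (a 0 * b 1 - a 1 * b 0)) ^ 2 =
        (x 0 ^ 2 + x 1 ^ 2 + x 2 ^ 2) * ((a 0 ^ 2 + a 1 ^ 2 + a 2 ^ 2) * (b 0 ^ 2 + b 1 ^ 2 + b 2 ^ 2)
          - (b 0 * a 0 + b 1 * a 1 + b 2 * a 2) ^ 2)
        - (x 0 * a 0 + x 1 * a 1 + x 2 * a 2) ^ 2 * (b 0 ^ 2 + b 1 ^ 2 + b 2 ^ 2)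
        - (x 0 * b 0 + x 1 * b 1 + x 2 * b 2) ^ 2 * (a 0 ^ 2 + a 1 ^ 2 + a 2 ^ 2)
        + 2 * (x 0 * a 0 + x 1 * a 1 + x 2 * a 2) * (x 0 * b 0 + x 1 * b 1 + x 2 * b 2)
          * (b 0 * a 0 + b 1 * a 1 + b 2 * a 2) := by ring
    rw [e, hA, hB] at gram
    linear_combination -gram

/-- For `k` in the cone `Σ`, the modulus of `ξ² + 2 k ξ` is expressed through `x = ξ + Re k` and
the two coordinates of `x` in the plane orthogonal to `Im k`. -/
theorem exists_frame {k : C3} (hk : k ∈ sigmaSet) :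
    ∃ a c : R3, ‖a‖ = ‖imVec k‖ ∧ ‖c‖ = ‖imVec k‖ ∧ ⟪a, c⟫ = 0 ∧
      ∀ ξ : R3, ‖denom k ξ‖ ^ 2 = (‖ξ + a‖ ^ 2 + ‖imVec k‖ ^ 2) ^ 2
        - 4 * (⟪ξ + a, a⟫ ^ 2 + ⟪ξ + a, c⟫ ^ 2) := by
  set b := imVec k with hb
  set a : R3 := WithLp.toLp 2 (fun j => (k j).re) with ha
  have hk' : ∑ j, k j ^ 2 = 0 := hk
  have hre := congrArg Complex.re hk'
  have him := congrArg Complex.im hk'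
  simp [Fin.sum_univ_three, pow_two] at hre him
  have hnorm : ‖a‖ ^ 2 = ‖b‖ ^ 2 := by
    simp only [EuclideanSpace.real_norm_sq_eq, Fin.sum_univ_three, ha, hb, imVec]
    linear_combination hre
  have hin : ⟪a, b⟫ = 0 := by
    simp only [PiLp.inner_apply, Fin.sum_univ_three, RCLike.inner_apply, conj_trivial, ha, hb,
      imVec]
    linear_combination him / 2
  have hn : ‖a‖ = ‖b‖ := (sq_eq_sq₀ (norm_nonneg _) (norm_nonneg _)).1 hnorm
  obtain ⟨c, hc, hac, hpars⟩ := exists_orthogonal_completion a b hn hin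
  refine ⟨a, c, hn, hc, hac, fun ξ => ?_⟩
  have hre : (denom k ξ).re = ‖ξ‖ ^ 2 + 2 * ⟪ξ, a⟫ := by
    simp [denom, bilin, PiLp.inner_apply, Fin.sum_univ_three, ha,
      -Complex.ofReal_pow]
  have him : (denom k ξ).im = 2 * ⟪ξ, b⟫ := by
    simp [denom, bilin, PiLp.inner_apply, Fin.sum_univ_three, hb, imVec,
      -Complex.ofReal_pow]
  have h1 : ‖denom k ξ‖ ^ 2 = (‖ξ‖ ^ 2 + 2 * ⟪ξ, a⟫) ^ 2 + (2 * ⟪ξ, b⟫) ^ 2 := by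
    rw [Complex.sq_norm, Complex.normSq_apply, hre, him]; ring
  have hp := hpars (ξ + a)
  have h2 : ‖ξ + a‖ ^ 2 = ‖ξ‖ ^ 2 + 2 * ⟪ξ, a⟫ + ‖b‖ ^ 2 := by
    rw [norm_add_sq_real, hnorm]
  have h3 : ⟪ξ + a, b⟫ = ⟪ξ, b⟫ := by rw [inner_add_left, hin, add_zero]
  rw [h3] at hp
  rw [h1]
  have h4 : ‖ξ‖ ^ 2 + 2 * ⟪ξ, a⟫ = ‖ξ + a‖ ^ 2 - ‖b‖ ^ 2 := by rw [h2]; ring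
  rw [h4]
  linear_combination -4 * hp

theorem norm_circlePt {a c : R3} {t : ℝ} (ha : ‖a‖ = t) (hc : ‖c‖ = t) (hac : ⟪a, c⟫ = 0)
    (θ : ℝ) : ‖circlePt a c θ‖ ^ 2 = t ^ 2 := by
  unfold circlePt
  rw [norm_add_sq_real, norm_smul, norm_smul, real_inner_smul_left, real_inner_smul_right, hac, ha,
    hc, mul_pow, mul_pow, Real.norm_eq_abs, Real.norm_eq_abs, sq_abs, sq_abs]
  linear_combination t ^ 2 * Real.sin_sq_add_cos_sq θ

theorem norm_sub_circlePt_sq {a c : R3} {t : ℝ} (ha : ‖a‖ = t) (hc : ‖c‖ = t) (hac : ⟪a, c⟫ = 0)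
    (x : R3) (θ : ℝ) : ‖x - circlePt a c θ‖ ^ 2 =
      ‖x‖ ^ 2 + t ^ 2 - 2 * (⟪x, a⟫ * Real.cos θ + ⟪x, c⟫ * Real.sin θ) := by
  rw [norm_sub_sq_real, norm_circlePt ha hc hac]
  unfold circlePt
  rw [inner_add_right, real_inner_smul_right, real_inner_smul_right]
  ring

theorem exists_polar (P Q : ℝ) : ∃ φ ∈ Set.Ioc (-Real.pi) Real.pi,
    P = √(P ^ 2 + Q ^ 2) * Real.cos φ ∧ Q = √(P ^ 2 + Q ^ 2) * Real.sin φ := by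
  have hz : ‖(⟨P, Q⟩ : ℂ)‖ = √(P ^ 2 + Q ^ 2) := by
    rw [Complex.norm_def, Complex.normSq_apply]; simp [pow_two]
  refine ⟨Complex.arg ⟨P, Q⟩, Complex.arg_mem_Ioc _, ?_, ?_⟩
  · rw [← hz, Complex.norm_mul_cos_arg]
  · rw [← hz, Complex.norm_mul_sin_arg]

/-- An interval of length at most `1` with one end at `φ` fits into `(-π, π]`. -/
theorem exists_window {φ h : ℝ} (hφ : φ ∈ Set.Ioc (-Real.pi) Real.pi) (h1 : h ≤ 1) :
    ∃ s, Set.Ioc s (s + h) ⊆ Set.Ioc (-Real.pi) Real.pi ∧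
      ∀ θ ∈ Set.Ioc s (s + h), (θ - φ) ^ 2 ≤ h ^ 2 := by
  have := Real.pi_gt_three
  rcases le_total φ 0 with hle | hle
  · refine ⟨φ, fun θ hθ => ⟨hφ.1.trans hθ.1, by linarith [hθ.2]⟩, fun θ hθ => ?_⟩
    have := hθ.1; have := hθ.2
    exact sq_le_sq' (by linarith) (by linarith)
  · refine ⟨φ - h, fun θ hθ => ⟨by linarith [hθ.1], by linarith [hθ.2, hφ.2]⟩, fun θ hθ => ?_⟩
    have := hθ.1; have := hθ.2
    exact sq_le_sq' (by linarith) (by linarith)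

/-- The reciprocal of `|d|` is dominated by an average over the circle of the kernel `|x - u|⁻²`.
In fact `1 / |d|` is exactly that average, since
`∫₀^{2π} dθ / (A - B cos θ) = 2π / √(A² - B²)`; for the inequality it suffices to integrate
over the part of the circle on which `|x - u|² ≤ (3/2) |d|`. -/
theorem enorm_inv_le_lintegral_circlePt {a c : R3} {t : ℝ} (ha : ‖a‖ = t) (hc : ‖c‖ = t)
    (hac : ⟪a, c⟫ = 0) (x : R3) (d : ℂ)
    (hd : ‖d‖ ^ 2 = (‖x‖ ^ 2 + t ^ 2) ^ 2 - 4 * (⟪x, a⟫ ^ 2 + ⟪x, c⟫ ^ 2)) :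
    ‖d⁻¹‖ₑ ≤ ENNReal.ofReal (3 / 2) * ∫⁻ θ in Set.Ioc (-Real.pi) Real.pi,
      {y : R3 | ‖y‖ ^ 2 ≤ 3 / 2 * ‖d‖}.indicator (fun y => (‖y‖ₑ ^ 2)⁻¹) (x - circlePt a c θ) := by
  rcases eq_or_ne d 0 with rfl | hd0
  · simp
  have hdpos : 0 < ‖d‖ := norm_pos_iff.mpr hd0
  set A := ‖x‖ ^ 2 + t ^ 2 with hA
  set r := √(⟪x, a⟫ ^ 2 + ⟪x, c⟫ ^ 2) with hr
  have hr0 : 0 ≤ r := Real.sqrt_nonneg _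
  have hr2 : r ^ 2 = ⟪x, a⟫ ^ 2 + ⟪x, c⟫ ^ 2 := Real.sq_sqrt (by positivity)
  have hA0 : 0 ≤ A := by positivity
  have hprod : ‖d‖ ^ 2 = (A - 2 * r) * (A + 2 * r) := by rw [hd, ← hr2]; ring
  have hAr : 0 < A - 2 * r := by
    by_contra hcon
    have : (A - 2 * r) * (A + 2 * r) ≤ 0 :=
      mul_nonpos_of_nonpos_of_nonneg (not_lt.mp hcon) (by positivity)
    have : 0 < ‖d‖ ^ 2 := by positivity
    linarith
  have hApos : 0 < A := by linarith
  set h := √((A - 2 * r) / A) with hh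
  have hh0 : 0 < h := Real.sqrt_pos.mpr (by positivity)
  have hh2 : h ^ 2 * A = A - 2 * r := by
    rw [hh, Real.sq_sqrt (by positivity)]; field_simp
  have hh1 : h ≤ 1 := by
    rw [hh]
    exact Real.sqrt_le_one.2 ((div_le_one hApos).2 (by linarith))
  -- `A - 2r = h² A`, and `(h A)² ≤ |d|²`
  have hhA : h * A ≤ ‖d‖ := by
    refine le_of_sq_le_sq ?_ hdpos.le
    nlinarith [mul_nonneg hAr.le hr0]
  obtain ⟨φ, hφ, hP, hQ⟩ := exists_polar ⟪x, a⟫ ⟪x, c⟫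
  rw [← hr] at hP hQ
  obtain ⟨s, hs, hwin⟩ := exists_window hφ hh1
  have hdist : ∀ θ ∈ Set.Ioc s (s + h), ‖x - circlePt a c θ‖ ^ 2 ≤ 3 / 2 * (h ^ 2 * A) := by
    intro θ hθ
    rw [norm_sub_circlePt_sq ha hc hac]
    have e : ⟪x, a⟫ * Real.cos θ + ⟪x, c⟫ * Real.sin θ = r * Real.cos (θ - φ) := by
      rw [Real.cos_sub, hP, hQ]; ring
    rw [e, ← hA]
    have hcos := Real.one_sub_sq_div_two_le_cos (x := θ - φ)
    have hw := hwin θ hθ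
    have h1 : r * (1 - h ^ 2 / 2) ≤ r * Real.cos (θ - φ) :=
      mul_le_mul_of_nonneg_left (by linarith) hr0
    nlinarith [mul_nonneg (sq_nonneg h) hAr.le]
  have hsmall : h ^ 2 * A ≤ ‖d‖ := by nlinarith [mul_nonneg hh0.le hA0]
  have hlow : ∀ θ ∈ Set.Ioc s (s + h), ENNReal.ofReal ((3 / 2 * (h ^ 2 * A))⁻¹) ≤
      {y : R3 | ‖y‖ ^ 2 ≤ 3 / 2 * ‖d‖}.indicator (fun y => (‖y‖ₑ ^ 2)⁻¹) (x - circlePt a c θ) := by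
    intro θ hθ
    have h1 := hdist θ hθ
    rw [Set.indicator_of_mem (by rw [Set.mem_ofPred_eq]; linarith),
      ENNReal.ofReal_inv_of_pos (by positivity), ENNReal.inv_le_inv, ← ofReal_norm,
      ← ENNReal.ofReal_pow (norm_nonneg _)]
    exact ENNReal.ofReal_le_ofReal h1
  calc ‖d⁻¹‖ₑ = ENNReal.ofReal (‖d‖⁻¹) := by rw [← ofReal_norm, norm_inv]
    _ ≤ ENNReal.ofReal (3 / 2 * ((3 / 2 * (h ^ 2 * A))⁻¹ * h)) := by
        refine ENNReal.ofReal_le_ofReal ?_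
        have : 3 / 2 * ((3 / 2 * (h ^ 2 * A))⁻¹ * h) = (h * A)⁻¹ := by field_simp
        rw [this]
        exact inv_anti₀ (by positivity) hhA
    _ = ENNReal.ofReal (3 / 2) *
          ∫⁻ _ in Set.Ioc s (s + h), ENNReal.ofReal ((3 / 2 * (h ^ 2 * A))⁻¹) := by
        rw [ENNReal.ofReal_mul (by norm_num), ENNReal.ofReal_mul (by positivity)]
        simp
    _ ≤ ENNReal.ofReal (3 / 2) * ∫⁻ θ in Set.Ioc s (s + h),
          {y : R3 | ‖y‖ ^ 2 ≤ 3 / 2 * ‖d‖}.indicator (fun y => (‖y‖ₑ ^ 2)⁻¹)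
            (x - circlePt a c θ) := by
        gcongr 1
        exact setLIntegral_mono' measurableSet_Ioc hlow
    _ ≤ _ := by
        gcongr 1
        exact lintegral_mono_set hs

/-- The distance from a point to a point of the circle is at least the distance from the latter to
the line through the centre and the projection of the former to the plane of the circle. -/
theorem exists_le_norm_sub_circlePt {a c : R3} {t : ℝ} (ht : 0 < t) (ha : ‖a‖ = t) (hc : ‖c‖ = t)
    (hac : ⟪a, c⟫ = 0) (x : R3) :
    ∃ ψ : ℝ, ∀ θ, t * |Real.sin (θ - ψ)| ≤ ‖x - circlePt a c θ‖ := by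
  obtain ⟨ψ, -, hP, hQ⟩ := exists_polar ⟪x, a⟫ ⟪x, c⟫
  refine ⟨ψ, fun θ => ?_⟩
  set r := √(⟪x, a⟫ ^ 2 + ⟪x, c⟫ ^ 2)
  -- the vector of the plane normal to the line
  set n : R3 := circlePt a c (ψ + Real.pi / 2) with hn
  have hnn : ‖n‖ = t := by
    have := norm_circlePt ha hc hac (ψ + Real.pi / 2)
    exact (sq_eq_sq₀ (norm_nonneg _) ht.le).1 this
  have hin : ⟪x - circlePt a c θ, n⟫ = -(t ^ 2 * Real.sin (θ - ψ)) := by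
    rw [inner_sub_left, hn]
    simp only [circlePt, Real.cos_add_pi_div_two, Real.sin_add_pi_div_two, inner_add_left,
      inner_add_right, real_inner_smul_left, real_inner_smul_right, hac, real_inner_comm a c,
      real_inner_self_eq_norm_sq, ha, hc]
    rw [hP, hQ, Real.sin_sub]
    ring
  have hcs := abs_real_inner_le_norm (x - circlePt a c θ) n
  rw [hin, hnn, abs_neg, abs_mul, abs_of_nonneg (by positivity : (0 : ℝ) ≤ t ^ 2)] at hcs
  refine le_of_mul_le_mul_right ?_ ht
  linarith [hcs, show t * |Real.sin (θ - ψ)| * t = t ^ 2 * |Real.sin (θ - ψ)| by ring]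

/-! ### Integrals of the Riesz kernel -/

/-- The radial majorant `1 / (|x| max(|x|, R))²`. -/
noncomputable def rieszProfile (R : ℝ) (x : R3) : ENNReal :=
  (‖x‖ₑ ^ 2 * max ‖x‖ₑ (ENNReal.ofReal R) ^ 2)⁻¹

theorem measurable_rieszProfile (R : ℝ) : Measurable (rieszProfile R) := by
  unfold rieszProfile; fun_prop

/-- The integral over `ℝ³` of `1 / (|x| max(|x|, 1))²`. -/
noncomputable def rieszConst : ENNReal := ∫⁻ x, rieszProfile 1 x

theorem rieszConst_lt_top : rieszConst < ⊤ := by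
  have hint : Integrable (fun x : R3 => (fun r : ℝ => (r ^ 2 * max r 1 ^ 2)⁻¹) ‖x‖) volume := by
    refine (integrable_fun_norm_addHaar (volume : Measure R3)
      (f := fun r : ℝ => (r ^ 2 * max r 1 ^ 2)⁻¹)).2 ?_
    have h1 : IntegrableOn (fun r : ℝ => (max r 1 ^ 2)⁻¹) (Set.Ioi 0) := by
      rw [← Set.Ioc_union_Ioi_eq_Ioi (zero_le_one' ℝ)]
      refine IntegrableOn.union ?_ ?_
      · refine (integrableOn_const (C := (1 : ℝ)) (s := Set.Ioc (0 : ℝ) 1) (by simp)).congr_fun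
          (fun r hr => ?_) measurableSet_Ioc
        simp [max_eq_right hr.2]
      · refine (integrableOn_Ioi_rpow_of_lt (a := -2) (by norm_num) one_pos).congr_fun
          (fun r hr => ?_) measurableSet_Ioi
        have : (0 : ℝ) < r := one_pos.trans hr
        simp only [max_eq_left (le_of_lt (Set.mem_Ioi.1 hr))]
        rw [Real.rpow_neg this.le]
        norm_cast
    refine h1.congr_fun (fun r hr => ?_) measurableSet_Ioi
    have : (0 : ℝ) < r := hr
    simp only [finrank_euclideanSpace, Fintype.card_fin, smul_eq_mul]
    field_simp
  have h2 := hint.lintegral_lt_top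
  refine lt_of_le_of_lt (le_of_eq ?_) h2
  refine lintegral_congr_ae ?_
  filter_upwards [compl_mem_ae_iff.2 (measure_singleton (0 : R3))] with x hx
  have hx0 : 0 < ‖x‖ := norm_pos_iff.2 hx
  rw [rieszProfile, ENNReal.ofReal_inv_of_pos (by positivity), ENNReal.ofReal_mul (by positivity),
    ENNReal.ofReal_pow (by positivity), ENNReal.ofReal_pow (by positivity), ENNReal.ofReal_max,
    ofReal_norm]

theorem lintegral_comp_smul_R3 {f : R3 → ENNReal} (hf : Measurable f) {R : ℝ} (hR : 0 < R) :
    ∫⁻ x, f (R • x) = ENNReal.ofReal ((R ^ 3)⁻¹) * ∫⁻ x, f x := by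
  have h := Measure.map_addHaar_smul (volume : Measure R3) hR.ne'
  rw [← lintegral_map hf (measurable_const_smul R), h, lintegral_smul_measure]
  simp [abs_of_pos hR]

theorem lintegral_rieszProfile {R : ℝ} (hR : 0 < R) :
    ∫⁻ x, rieszProfile R x = (ENNReal.ofReal R)⁻¹ * rieszConst := by
  have hR0 : ENNReal.ofReal R ≠ 0 := by simpa using hR
  have hRt : ENNReal.ofReal R ≠ ⊤ := ENNReal.ofReal_ne_top
  have hs : ∀ x : R3, rieszProfile R (R • x) = (ENNReal.ofReal R ^ 4)⁻¹ * rieszProfile 1 x := by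
    intro x
    have e : ‖R • x‖ₑ = ENNReal.ofReal R * ‖x‖ₑ := by
      rw [enorm_smul, Real.enorm_eq_ofReal hR.le]
    have e2 : max (ENNReal.ofReal R * ‖x‖ₑ) (ENNReal.ofReal R) =
        ENNReal.ofReal R * max ‖x‖ₑ (ENNReal.ofReal 1) := by
      rw [ENNReal.ofReal_one, mul_max, mul_one]
    rw [rieszProfile, rieszProfile, e, e2, ← ENNReal.mul_inv (by simp [hR]) (by simp)]
    congr 1
    ring
  have h := lintegral_comp_smul_R3 (measurable_rieszProfile R) hR
  simp_rw [hs] at h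
  rw [lintegral_const_mul _ (measurable_rieszProfile 1)] at h
  have h3 : ENNReal.ofReal ((R ^ 3)⁻¹) = (ENNReal.ofReal R ^ 3)⁻¹ := by
    rw [ENNReal.ofReal_inv_of_pos (by positivity), ENNReal.ofReal_pow hR.le]
  rw [h3] at h
  have h4 := congrArg (fun z => ENNReal.ofReal R ^ 3 * z) h
  simp only [← mul_assoc] at h4
  rw [ENNReal.mul_inv_cancel (by simp [hR]) (by simp), one_mul] at h4
  rw [← h4, rieszConst]
  congr 1
  rw [pow_succ (ENNReal.ofReal R) 3, ENNReal.mul_inv (by simp [hR]) (by simp), ← mul_assoc,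
    ENNReal.mul_inv_cancel (by simp [hR]) (by simp), one_mul]

/-- The integral of the Riesz kernel over a ball. -/
theorem lintegral_indicator_inv_sq_le {s : ℝ} (hs : 0 ≤ s) (c : R3) :
    ∫⁻ x : R3, {y : R3 | ‖y‖ ^ 2 ≤ s}.indicator (fun y => (‖y‖ₑ ^ 2)⁻¹) (x - c) ≤
      ENNReal.ofReal (√s) * rieszConst := by
  rw [lintegral_sub_right_eq_self (fun x => {y : R3 | ‖y‖ ^ 2 ≤ s}.indicator
    (fun y => (‖y‖ₑ ^ 2)⁻¹) x) c]
  rcases hs.eq_or_lt with rfl | hs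
  · rw [Real.sqrt_zero, ENNReal.ofReal_zero, zero_mul, nonpos_iff_eq_zero]
    refine lintegral_eq_zero_of_ae_eq_zero ?_
    filter_upwards [compl_mem_ae_iff.2 (measure_singleton (0 : R3))] with x hx
    refine Set.indicator_of_notMem ?_ _
    have : 0 < ‖x‖ := norm_pos_iff.2 hx
    rw [Set.mem_ofPred_eq, not_le]
    positivity
  have hR : 0 < √s := Real.sqrt_pos.2 hs
  have hle : ∀ x : R3, {y : R3 | ‖y‖ ^ 2 ≤ s}.indicator (fun y => (‖y‖ₑ ^ 2)⁻¹) x ≤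
      ENNReal.ofReal (√s) ^ 2 * rieszProfile (√s) x := by
    intro x
    by_cases hx : x ∈ {y : R3 | ‖y‖ ^ 2 ≤ s}
    · rw [Set.indicator_of_mem hx]
      have hx' : ‖x‖ₑ ≤ ENNReal.ofReal (√s) := by
        rw [← ofReal_norm]
        exact ENNReal.ofReal_le_ofReal (Real.le_sqrt_of_sq_le hx)
      rw [rieszProfile, max_eq_right hx', ENNReal.mul_inv (by simp) (by simp), mul_left_comm,
        ENNReal.mul_inv_cancel (by simp [hs]) (by simp), mul_one]
    · rw [Set.indicator_of_notMem hx]; exact zero_le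
  calc _ ≤ ∫⁻ x, ENNReal.ofReal (√s) ^ 2 * rieszProfile (√s) x := lintegral_mono hle
    _ = _ := by
      rw [lintegral_const_mul _ (measurable_rieszProfile _), lintegral_rieszProfile hR, ← mul_assoc,
        pow_two, mul_assoc (ENNReal.ofReal _), ENNReal.mul_inv_cancel (by simpa using hR) (by simp),
        mul_one]

/-- The weight `(1 + |y|)⁻²`. -/
noncomputable def sqWeight (y : R3) : ENNReal := ((1 + ‖y‖ₑ) ^ 2)⁻¹

theorem measurable_sqWeight : Measurable sqWeight := by unfold sqWeight; fun_prop

/-- The convolution of the weight `(1 + |·|)⁻²` with the Riesz kernel `|·|⁻²` decays like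
`1 / (1 + |·|)`: of the two factors, the smaller one is at most `4 / (1 + |q - c|)²`, and the
product is dominated by a radial profile about one of the two centres. -/
theorem lintegral_sqWeight_mul_inv_sq_le (q c : R3) :
    ∫⁻ ξ, sqWeight (ξ - q) * (‖ξ - c‖ₑ ^ 2)⁻¹ ≤
      4 * rieszConst * ENNReal.ofReal ((1 + ‖q - c‖)⁻¹) := by
  set R : ℝ := (1 + ‖q - c‖) / 2 with hR
  have hRpos : 0 < R := by positivity
  have hpt : ∀ ξ, sqWeight (ξ - q) * (‖ξ - c‖ₑ ^ 2)⁻¹ ≤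
      rieszProfile R (ξ - c) + rieszProfile R (ξ - q) := by
    intro ξ
    have hm : (1 + ‖ξ - q‖ₑ) = ENNReal.ofReal (1 + ‖ξ - q‖) := by
      rw [ENNReal.ofReal_add zero_le_one (norm_nonneg _), ENNReal.ofReal_one, ofReal_norm]
    have htri : 2 * R ≤ (1 + ‖ξ - q‖) + ‖ξ - c‖ := by
      have : ‖q - c‖ ≤ ‖ξ - q‖ + ‖ξ - c‖ := by
        have := norm_sub_le (ξ - c) (ξ - q)
        rw [show ξ - c - (ξ - q) = q - c by abel] at this
        linarith
      rw [hR]; linarith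
    rw [sqWeight, ← ENNReal.mul_inv (by simp) (by simp)]
    rcases le_total ‖ξ - c‖ (1 + ‖ξ - q‖) with h | h
    · refine le_trans ?_ le_self_add
      rw [rieszProfile, ENNReal.inv_le_inv, mul_comm]
      gcongr
      rw [hm, ← ofReal_norm]
      exact max_le (ENNReal.ofReal_le_ofReal h) (ENNReal.ofReal_le_ofReal (by linarith))
    · refine le_trans ?_ le_add_self
      rw [rieszProfile, ENNReal.inv_le_inv]
      gcongr
      · exact le_add_self
      · rw [← ofReal_norm, ← ofReal_norm]
        exact max_le (ENNReal.ofReal_le_ofReal (by linarith))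
          (ENNReal.ofReal_le_ofReal (by linarith))
  have hinv : (ENNReal.ofReal R)⁻¹ = 2 * ENNReal.ofReal ((1 + ‖q - c‖)⁻¹) := by
    rw [← ENNReal.ofReal_inv_of_pos hRpos, hR, inv_div, div_eq_mul_inv,
      ENNReal.ofReal_mul (by norm_num), ENNReal.ofReal_ofNat]
  calc _ ≤ ∫⁻ ξ, (rieszProfile R (ξ - c) + rieszProfile R (ξ - q)) := lintegral_mono hpt
    _ = (∫⁻ ξ, rieszProfile R (ξ - c)) + ∫⁻ ξ, rieszProfile R (ξ - q) :=
        lintegral_add_left ((measurable_rieszProfile R).comp (measurable_id.sub_const c)) _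
    _ = 2 * ((ENNReal.ofReal R)⁻¹ * rieszConst) := by
        rw [lintegral_sub_right_eq_self (rieszProfile R) c,
          lintegral_sub_right_eq_self (rieszProfile R) q, lintegral_rieszProfile hRpos, two_mul]
    _ = 4 * rieszConst * ENNReal.ofReal ((1 + ‖q - c‖)⁻¹) := by
        rw [hinv, show (4 : ENNReal) = 2 * 2 by norm_num]; ring

theorem measurable_denom (k : C3) : Measurable (denom k) := by
  unfold denom bilin
  fun_prop

/-- The weighted integral of `1 / |ξ² + 2 k ξ|` is an average over a circle of radius `|Im k|` of
the function `1 / (1 + |·|)`, up to a constant. -/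
theorem exists_lintegral_sqWeight_mul_le {k : C3} (hk : k ∈ sigmaSet) :
    ∃ a c : R3, ‖a‖ = ‖imVec k‖ ∧ ‖c‖ = ‖imVec k‖ ∧ ⟪a, c⟫ = 0 ∧ ∀ q : R3,
      ∫⁻ ξ, sqWeight (ξ - q) * ‖(denom k ξ)⁻¹‖ₑ ≤ 6 * rieszConst *
        ∫⁻ θ in Set.Ioc (-Real.pi) Real.pi,
          ENNReal.ofReal ((1 + ‖q + a - circlePt a c θ‖)⁻¹) := by
  obtain ⟨a, c, ha, hc, hac, hd⟩ := exists_frame hk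
  refine ⟨a, c, ha, hc, hac, fun q => ?_⟩
  have hmeas : Measurable (fun z : R3 × ℝ =>
      sqWeight (z.1 - q) * (‖z.1 + a - circlePt a c z.2‖ₑ ^ 2)⁻¹) := by
    have h1 : Measurable (fun z : R3 × ℝ => sqWeight (z.1 - q)) :=
      measurable_sqWeight.comp (by fun_prop)
    have h2 : Continuous (fun z : R3 × ℝ => z.1 + a - circlePt a c z.2) := by
      unfold circlePt; fun_prop
    exact h1.mul ((h2.measurable.enorm.pow_const 2).inv)
  calc ∫⁻ ξ, sqWeight (ξ - q) * ‖(denom k ξ)⁻¹‖ₑ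
      ≤ ∫⁻ ξ, ENNReal.ofReal (3 / 2) * ∫⁻ θ in Set.Ioc (-Real.pi) Real.pi,
          sqWeight (ξ - q) * (‖ξ + a - circlePt a c θ‖ₑ ^ 2)⁻¹ := by
        refine lintegral_mono fun ξ => ?_
        rw [lintegral_const_mul _ (by
          have := (continuous_circlePt a c).measurable
          fun_prop), mul_left_comm]
        gcongr 1
        refine (enorm_inv_le_lintegral_circlePt ha hc hac _ _ (hd ξ)).trans ?_
        gcongr 1
        exact lintegral_mono fun θ => Set.indicator_le_self _ _ _
    _ = ENNReal.ofReal (3 / 2) * ∫⁻ θ in Set.Ioc (-Real.pi) Real.pi, ∫⁻ ξ,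
          sqWeight (ξ - q) * (‖ξ + a - circlePt a c θ‖ₑ ^ 2)⁻¹ := by
        rw [lintegral_const_mul _ hmeas.lintegral_prod_right']
        congr 1
        exact lintegral_lintegral_swap hmeas.aemeasurable
    _ ≤ ENNReal.ofReal (3 / 2) * ∫⁻ θ in Set.Ioc (-Real.pi) Real.pi,
          4 * rieszConst * ENNReal.ofReal ((1 + ‖q + a - circlePt a c θ‖)⁻¹) := by
        gcongr with θ
        have h := lintegral_sqWeight_mul_inv_sq_le q (circlePt a c θ - a)
        simpa only [sub_sub_eq_add_sub] using h
    _ = _ := by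
        rw [lintegral_const_mul _ (by
          have := (continuous_circlePt a c).measurable
          fun_prop), ← mul_assoc, ← mul_assoc]
        congr 2
        rw [show (4 : ENNReal) = ENNReal.ofReal 4 by simp, ← ENNReal.ofReal_mul (by norm_num)]
        norm_num

/-- The part of the integral of `1 / |ξ² + 2 k ξ|` near the zeros of the denominator is
`O(√δ)`, uniformly in `k`. -/
theorem lintegral_indicator_denom_le {k : C3} (hk : k ∈ sigmaSet) {δ : ℝ} (hδ : 0 < δ) :
    ∫⁻ ξ, {ξ : R3 | ‖denom k ξ‖ ≤ δ}.indicator (fun ξ => ‖(denom k ξ)⁻¹‖ₑ) ξ ≤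
      ENNReal.ofReal (3 * Real.pi * √(3 / 2 * δ)) * rieszConst := by
  obtain ⟨a, c, ha, hc, hac, hd⟩ := exists_frame hk
  have hmeas : Measurable (fun z : R3 × ℝ =>
      {y : R3 | ‖y‖ ^ 2 ≤ 3 / 2 * δ}.indicator (fun y => (‖y‖ₑ ^ 2)⁻¹)
        (z.1 + a - circlePt a c z.2)) := by
    have h2 : Continuous (fun z : R3 × ℝ => z.1 + a - circlePt a c z.2) := by
      unfold circlePt; fun_prop
    refine Measurable.comp (Measurable.indicator (by fun_prop) ?_) h2.measurable
    exact measurableSet_le (by fun_prop) (by fun_prop)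
  calc _ ≤ ∫⁻ ξ, ENNReal.ofReal (3 / 2) * ∫⁻ θ in Set.Ioc (-Real.pi) Real.pi,
          {y : R3 | ‖y‖ ^ 2 ≤ 3 / 2 * δ}.indicator (fun y => (‖y‖ₑ ^ 2)⁻¹)
            (ξ + a - circlePt a c θ) := by
        refine lintegral_mono fun ξ => ?_
        by_cases hξ : ξ ∈ {ξ : R3 | ‖denom k ξ‖ ≤ δ}
        swap
        · rw [Set.indicator_of_notMem hξ]; exact zero_le
        rw [Set.indicator_of_mem hξ]
        refine (enorm_inv_le_lintegral_circlePt ha hc hac _ _ (hd ξ)).trans ?_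
        gcongr 1
        refine lintegral_mono fun θ => Set.indicator_le_indicator_of_subset (fun y hy => ?_)
          (fun _ => zero_le) _
        have h1 : ‖denom k ξ‖ ≤ δ := hξ
        have h2 : ‖y‖ ^ 2 ≤ 3 / 2 * ‖denom k ξ‖ := hy
        rw [Set.mem_ofPred_eq]
        linarith
    _ = ENNReal.ofReal (3 / 2) * ∫⁻ θ in Set.Ioc (-Real.pi) Real.pi, ∫⁻ ξ,
          {y : R3 | ‖y‖ ^ 2 ≤ 3 / 2 * δ}.indicator (fun y => (‖y‖ₑ ^ 2)⁻¹)
            (ξ + a - circlePt a c θ) := by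
        rw [lintegral_const_mul _ hmeas.lintegral_prod_right']
        congr 1
        exact lintegral_lintegral_swap hmeas.aemeasurable
    _ ≤ ENNReal.ofReal (3 / 2) * ∫⁻ θ in Set.Ioc (-Real.pi) Real.pi,
          ENNReal.ofReal (√(3 / 2 * δ)) * rieszConst := by
        gcongr with θ
        have h := lintegral_indicator_inv_sq_le (s := 3 / 2 * δ) (by positivity)
          (circlePt a c θ - a)
        simpa only [sub_sub_eq_add_sub] using h
    _ = _ := by
        rw [lintegral_const, Measure.restrict_apply_univ, Real.volume_Ioc,
          ENNReal.ofReal_mul (p := 3 * Real.pi) (by positivity),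
          show 3 * Real.pi = 3 / 2 * (Real.pi - -Real.pi) by ring,
          ENNReal.ofReal_mul (p := 3 / 2) (by norm_num)]
        ring

/-! ### Bounds for the model integral -/

/-- The average of `1 / (1 + t |sin|)` over a circle is of order `log (1 + t) / t`. -/
theorem lintegral_inv_one_add_sin_le {t : ℝ} (ht : 0 < t) (ψ : ℝ) :
    ∫⁻ θ in Set.Ioc (-Real.pi) Real.pi, ENNReal.ofReal ((1 + t * |Real.sin (θ - ψ)|)⁻¹) ≤
      ENNReal.ofReal (2 * Real.pi * (Real.log (1 + t) / t)) := by
  have hπ := Real.pi_pos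
  set f : ℝ → ℝ := fun s => (1 + t * |Real.sin s|)⁻¹ with hf
  have hfc : Continuous f := by
    refine Continuous.inv₀ (by fun_prop) fun s => ?_
    positivity
  have hper : Function.Periodic f Real.pi := fun s => by
    simp only [hf, Real.sin_add_pi, abs_neg]
  have hint : ∀ a b, IntervalIntegrable f volume a b := fun a b => hfc.intervalIntegrable a b
  have hle : -Real.pi ≤ Real.pi := by linarith
  have hshift : ∫ θ in (-Real.pi)..Real.pi, f (θ - ψ) =
      2 * ∫ s in (-(Real.pi / 2))..(Real.pi / 2), f s := by
    rw [intervalIntegral.integral_comp_sub_right f ψ,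
      ← intervalIntegral.integral_add_adjacent_intervals (hint _ (-ψ)) (hint _ _)]
    have e := hper.intervalIntegral_add_eq (-(Real.pi / 2))
    have e1 := e (-Real.pi - ψ)
    have e2 := e (-ψ)
    rw [show -(Real.pi / 2) + Real.pi = Real.pi / 2 by ring] at e1 e2
    rw [show -Real.pi - ψ + Real.pi = -ψ by ring] at e1
    rw [show -ψ + Real.pi = Real.pi - ψ by ring] at e2
    rw [← e1, ← e2, two_mul]
  have heven : ∫ s in (-(Real.pi / 2))..(Real.pi / 2), f s =
      2 * ∫ s in (0 : ℝ)..(Real.pi / 2), f s := by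
    rw [← intervalIntegral.integral_add_adjacent_intervals (hint _ 0) (hint _ _), two_mul]
    congr 1
    have := intervalIntegral.integral_comp_neg (a := 0) (b := Real.pi / 2) f
    rw [neg_zero] at this
    rw [← this]
    simp only [hf, Real.sin_neg, abs_neg]
  have hquarter : ∫ s in (0 : ℝ)..(Real.pi / 2), f s ≤ Real.pi / 2 * (Real.log (1 + t) / t) := by
    have hg : ∫ s in (0 : ℝ)..(Real.pi / 2), (fun y => y⁻¹) (1 + 2 * t / Real.pi * s) =
        Real.pi / 2 * (Real.log (1 + t) / t) := by
      rw [intervalIntegral.integral_comp_add_mul _ (by positivity),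
        integral_inv_of_pos (by positivity) (by positivity)]
      rw [show (1 + 2 * t / Real.pi * (Real.pi / 2)) / (1 + 2 * t / Real.pi * 0) = 1 + t by
        field_simp; simp]
      simp only [smul_eq_mul]
      field_simp
    rw [← hg]
    refine intervalIntegral.integral_mono_on (by positivity) (hint _ _) ?_ fun s hs => ?_
    · refine ContinuousOn.intervalIntegrable (ContinuousOn.inv₀ (by fun_prop) fun s hs => ?_)
      rw [Set.uIcc_of_le (by positivity)] at hs
      have := hs.1
      positivity
    · have hs0 := hs.1
      have h1 := Real.mul_le_sin hs0 hs.2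
      refine inv_anti₀ (by positivity) ?_
      have h2 : t * (2 / Real.pi * s) ≤ t * |Real.sin s| :=
        mul_le_mul_of_nonneg_left (h1.trans (le_abs_self _)) ht.le
      calc 1 + 2 * t / Real.pi * s = 1 + t * (2 / Real.pi * s) := by ring
        _ ≤ _ := by linarith
  have htot : ∫ θ in (-Real.pi)..Real.pi, f (θ - ψ) ≤ 2 * Real.pi * (Real.log (1 + t) / t) := by
    rw [hshift, heven]
    linarith
  rw [intervalIntegral.integral_of_le hle] at htot
  rw [← ofReal_integral_eq_lintegral_ofReal]
  · exact ENNReal.ofReal_le_ofReal htot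
  · have := (hfc.comp (continuous_sub_right ψ)).intervalIntegrable (μ := volume)
      (-Real.pi) Real.pi
    rw [intervalIntegrable_iff_integrableOn_Ioc_of_le hle] at this
    exact this
  · refine Filter.Eventually.of_forall fun θ => ?_
    simp only [Pi.zero_apply]
    positivity

/-- The weight `(1 + |y|)^{-μ}`. -/
noncomputable def decay (μ : ℝ) (y : R3) : ℝ := (1 + ‖y‖) ^ (-μ)

theorem decay_pos (μ : ℝ) (y : R3) : 0 < decay μ y := Real.rpow_pos_of_pos (by positivity) _

theorem continuous_decay (μ : ℝ) : Continuous (decay μ) := by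
  unfold decay
  exact Continuous.rpow_const (by fun_prop) fun y => Or.inl (by positivity)

theorem decay_neg (μ : ℝ) (y : R3) : decay μ (-y) = decay μ y := by simp [decay]

/-- For `μ ≥ 2` the weight is dominated by `(1 + |y|)⁻²`. -/
theorem decay_le {μ : ℝ} (hμ : 2 ≤ μ) (y : R3) : decay μ y ≤ ((1 + ‖y‖) ^ 2)⁻¹ := by
  have h1 : 1 ≤ 1 + ‖y‖ := by linarith [norm_nonneg y]
  calc decay μ y ≤ (1 + ‖y‖) ^ (-2 : ℝ) := Real.rpow_le_rpow_of_exponent_le h1 (by linarith)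
    _ = _ := by
      rw [Real.rpow_neg (by positivity)]
      norm_cast

theorem decay_le_one {μ : ℝ} (hμ : 2 ≤ μ) (y : R3) : decay μ y ≤ 1 := by
  refine (decay_le hμ y).trans (inv_le_one_of_one_le₀ (one_le_pow₀ ?_))
  linarith [norm_nonneg y]

theorem ofReal_inv_sq_eq_sqWeight (y : R3) :
    ENNReal.ofReal (((1 + ‖y‖) ^ 2)⁻¹) = sqWeight y := by
  rw [sqWeight, ENNReal.ofReal_inv_of_pos (by positivity), ENNReal.ofReal_pow (by positivity),
    ENNReal.ofReal_add zero_le_one (norm_nonneg _), ENNReal.ofReal_one, ofReal_norm]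

/-- Since `|p| ≤ |p + ξ| + |ξ|`, the larger of the two factors on the left is controlled by the
decay in `p`. -/
theorem decay_mul_decay_le {μ : ℝ} (hμ : 2 ≤ μ) (p ξ : R3) :
    decay μ (p + ξ) * decay μ ξ ≤
      2 ^ μ * decay μ p * (((1 + ‖p + ξ‖) ^ 2)⁻¹ + ((1 + ‖ξ‖) ^ 2)⁻¹) := by
  have hz : 2 ^ μ * decay μ p = ((1 + ‖p‖) / 2) ^ (-μ) := by
    rw [Real.div_rpow (by positivity) (by norm_num), Real.rpow_neg (by norm_num : (0 : ℝ) ≤ 2),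
      div_inv_eq_mul, decay, mul_comm]
  have htri : ‖p‖ ≤ ‖p + ξ‖ + ‖ξ‖ := by
    have := norm_sub_le (p + ξ) ξ
    rwa [add_sub_cancel_right] at this
  have hbig : ∀ y : R3, (1 + ‖p‖) / 2 ≤ 1 + ‖y‖ → decay μ y ≤ 2 ^ μ * decay μ p := fun y hy => by
    rw [hz]
    exact Real.rpow_le_rpow_of_nonpos (by positivity) hy (by linarith)
  rcases le_total ‖ξ‖ ‖p + ξ‖ with h | h
  · refine mul_le_mul (hbig _ (by linarith)) ((decay_le hμ ξ).trans ?_) (decay_pos _ _).le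
      (by have := decay_pos μ p; positivity)
    exact le_add_of_nonneg_left (by positivity)
  · rw [mul_comm (decay μ (p + ξ))]
    refine mul_le_mul (hbig _ (by linarith)) ((decay_le hμ _).trans ?_) (decay_pos _ _).le
      (by have := decay_pos μ p; positivity)
    exact le_add_of_nonneg_right (by positivity)

/-- The statement that `c` bounds the norm of `A(k)`, as a bilinear operator in `v̂` and `U`, for
the weighted norms: the model integral in which `v̂` and `U` are replaced by `(1 + |·|)^{-μ}` is at
most `c (1 + |p|)^{-μ}`. -/
def KernelBound (μ : ℝ) (k : C3) (c : ℝ) : Prop :=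
  ∀ p : R3, ∫⁻ ξ, ENNReal.ofReal (decay μ (p + ξ) * decay μ ξ) * ‖(denom k ξ)⁻¹‖ₑ ≤
    ENNReal.ofReal (c * decay μ p)

theorem kernelBound_of_forall_lintegral_le {μ : ℝ} (hμ : 2 ≤ μ) {k : C3} {c : ℝ} (hc : 0 ≤ c)
    (h : ∀ q : R3, ∫⁻ ξ, sqWeight (ξ - q) * ‖(denom k ξ)⁻¹‖ₑ ≤ ENNReal.ofReal c) :
    KernelBound μ k (2 ^ μ * (2 * c)) := by
  intro p
  have hd : Measurable fun ξ => ‖(denom k ξ)⁻¹‖ₑ := (measurable_denom k).inv.enorm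
  have hpos := decay_pos μ p
  calc _ ≤ ∫⁻ ξ, ENNReal.ofReal (2 ^ μ * decay μ p) *
          (sqWeight (ξ - -p) * ‖(denom k ξ)⁻¹‖ₑ + sqWeight (ξ - 0) * ‖(denom k ξ)⁻¹‖ₑ) := by
        refine lintegral_mono fun ξ => ?_
        rw [← add_mul, ← mul_assoc]
        gcongr 1
        rw [sub_neg_eq_add, sub_zero, add_comm ξ p, ← ofReal_inv_sq_eq_sqWeight,
          ← ofReal_inv_sq_eq_sqWeight, ← ENNReal.ofReal_add (by positivity) (by positivity),
          ← ENNReal.ofReal_mul (by positivity)]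
        exact ENNReal.ofReal_le_ofReal (decay_mul_decay_le hμ p ξ)
    _ = ENNReal.ofReal (2 ^ μ * decay μ p) * ((∫⁻ ξ, sqWeight (ξ - -p) * ‖(denom k ξ)⁻¹‖ₑ) +
          ∫⁻ ξ, sqWeight (ξ - 0) * ‖(denom k ξ)⁻¹‖ₑ) := by
        have hw : ∀ q, Measurable fun ξ => sqWeight (ξ - q) * ‖(denom k ξ)⁻¹‖ₑ := fun q =>
          (measurable_sqWeight.comp (measurable_id.sub_const q)).mul hd
        rw [lintegral_const_mul _ (by exact (hw _).add (hw _)), lintegral_add_left (hw _)]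
    _ ≤ ENNReal.ofReal (2 ^ μ * decay μ p) * (ENNReal.ofReal c + ENNReal.ofReal c) := by
        gcongr <;> exact h _
    _ = _ := by
        rw [← ENNReal.ofReal_add hc hc, ← ENNReal.ofReal_mul (by positivity)]
        congr 1
        ring

/-- Uniform boundedness of `A(k)` on the cone, and decay for large `|Im k|`. -/
theorem exists_kernelBound {μ : ℝ} (hμ : 2 ≤ μ) : ∃ c : ℝ, 0 < c ∧
    (∀ k ∈ sigmaSet, KernelBound μ k c) ∧
    ∀ k ∈ sigmaSet, 0 < ‖imVec k‖ → 2 ≤ Real.log ‖imVec k‖ →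
      KernelBound μ k (c * (Real.log ‖imVec k‖ ^ 2 / ‖imVec k‖)) := by
  have hπ := Real.pi_pos
  -- the summand `1` makes the positivity of the constant evident
  set K : ℝ := rieszConst.toReal + 1 with hK
  have hKpos : 0 < K := by positivity
  have hKle : rieszConst ≤ ENNReal.ofReal K := by
    rw [← ENNReal.ofReal_toReal rieszConst_lt_top.ne]
    exact ENNReal.ofReal_le_ofReal (by linarith)
  have hbase : ∀ {I : ENNReal} {s : ℝ}, 0 ≤ s → I ≤ ENNReal.ofReal (2 * Real.pi * s) →
      6 * rieszConst * I ≤ ENNReal.ofReal (12 * Real.pi * K * s) := by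
    intro I s hs hI
    calc 6 * rieszConst * I ≤ 6 * ENNReal.ofReal K * ENNReal.ofReal (2 * Real.pi * s) := by gcongr
      _ = _ := by
        rw [show (6 : ENNReal) = ENNReal.ofReal 6 by simp, ← ENNReal.ofReal_mul (by norm_num),
          ← ENNReal.ofReal_mul (by positivity)]
        congr 1
        ring
  refine ⟨2 ^ μ * (2 * (12 * Real.pi * K)), by positivity, fun k hk => ?_, fun k hk ht hlog => ?_⟩
  · obtain ⟨a, c, -, -, -, h⟩ := exists_lintegral_sqWeight_mul_le hk
    refine kernelBound_of_forall_lintegral_le hμ (by positivity) fun q => (h q).trans ?_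
    rw [← mul_one (12 * Real.pi * K)]
    refine hbase zero_le_one ?_
    calc _ ≤ ∫⁻ _ in Set.Ioc (-Real.pi) Real.pi, (1 : ENNReal) := by
          refine lintegral_mono fun θ => ?_
          rw [← ENNReal.ofReal_one]
          refine ENNReal.ofReal_le_ofReal (inv_le_one_of_one_le₀ ?_)
          linarith [norm_nonneg (q + a - circlePt a c θ)]
      _ = _ := by
          rw [lintegral_one, Measure.restrict_apply_univ, Real.volume_Ioc]
          congr 1
          ring
  · set t := ‖imVec k‖ with htdef
    have ht3 : 3 ≤ t := by
      have h1 := Real.add_one_le_exp (2 : ℝ)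
      have h2 := (Real.le_log_iff_exp_le ht).1 hlog
      linarith
    obtain ⟨a, c, ha, hc, hac, h⟩ := exists_lintegral_sqWeight_mul_le hk
    rw [mul_assoc, mul_assoc]
    refine kernelBound_of_forall_lintegral_le hμ (by positivity) fun q => (h q).trans ?_
    refine hbase (by positivity) ?_
    obtain ⟨ψ, hψ⟩ := exists_le_norm_sub_circlePt ht ha hc hac (q + a)
    calc _ ≤ ∫⁻ θ in Set.Ioc (-Real.pi) Real.pi,
            ENNReal.ofReal ((1 + t * |Real.sin (θ - ψ)|)⁻¹) := by
          refine lintegral_mono fun θ => ENNReal.ofReal_le_ofReal (inv_anti₀ (by positivity) ?_)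
          linarith [hψ θ]
      _ ≤ _ := lintegral_inv_one_add_sin_le ht ψ
      _ ≤ _ := by
          refine ENNReal.ofReal_le_ofReal ?_
          gcongr
          -- `log (1 + t) ≤ log t² = 2 log t ≤ (log t)²`
          have h1 : Real.log (1 + t) ≤ Real.log (t ^ 2) :=
            Real.log_le_log (by positivity) (by nlinarith)
          rw [Real.log_pow] at h1
          push_cast at h1
          nlinarith

/-! ### The weighted norm and pointwise bounds for `A(k)` -/

theorem ofReal_weighted_le_iff {μ M : ℝ} (hM : 0 ≤ M) (u : R3 → ℂ) (p : R3) :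
    ENNReal.ofReal ((1 + ‖p‖) ^ μ * ‖u p‖) ≤ ENNReal.ofReal M ↔ ‖u p‖ ≤ M * decay μ p := by
  have h : 0 < (1 + ‖p‖) ^ μ := Real.rpow_pos_of_pos (by positivity) _
  rw [ENNReal.ofReal_le_ofReal_iff hM, decay, Real.rpow_neg (by positivity), ← div_eq_mul_inv,
    le_div_iff₀ h, mul_comm]

/-- The weighted norm is at most `M` precisely when `|u| ≤ M (1 + |·|)^{-μ}` almost everywhere. -/
theorem lmuNorm_le_ofReal_iff {μ M : ℝ} (hM : 0 ≤ M) {u : R3 → ℂ} :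
    lmuNorm μ u ≤ ENNReal.ofReal M ↔ ∀ᵐ p, ‖u p‖ ≤ M * decay μ p := by
  constructor
  · intro h
    filter_upwards [ENNReal.ae_le_essSup
      (fun p => ENNReal.ofReal ((1 + ‖p‖) ^ μ * ‖u p‖))] with p hp
    exact (ofReal_weighted_le_iff hM u p).1 (hp.trans h)
  · intro h
    refine essSup_le_of_ae_le _ ?_
    filter_upwards [h] with p hp
    exact (ofReal_weighted_le_iff hM u p).2 hp

theorem MemLmu.ae_le {μ : ℝ} {u : R3 → ℂ} (hu : MemLmu μ u) :
    ∀ᵐ p, ‖u p‖ ≤ (lmuNorm μ u).toReal * decay μ p := by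
  rw [← lmuNorm_le_ofReal_iff ENNReal.toReal_nonneg, ENNReal.ofReal_toReal hu.2.ne]

theorem memLmu_of_ae_le {μ M : ℝ} (hμ : 2 ≤ μ) (hM : 0 ≤ M) {u : R3 → ℂ}
    (hm : AEStronglyMeasurable u volume) (h : ∀ᵐ p, ‖u p‖ ≤ M * decay μ p) : MemLmu μ u := by
  refine ⟨memLp_top_of_bound hm M ?_, ?_⟩
  · filter_upwards [h] with p hp
    exact hp.trans (mul_le_of_le_one_right hM (decay_le_one hμ p))
  · exact ((lmuNorm_le_ofReal_iff hM).2 h).trans_lt ENNReal.ofReal_lt_top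

theorem MemLmu.sub {μ : ℝ} (hμ : 2 ≤ μ) {u w : R3 → ℂ} (hu : MemLmu μ u) (hw : MemLmu μ w) :
    MemLmu μ (fun p => u p - w p) := by
  refine memLmu_of_ae_le (M := (lmuNorm μ u).toReal + (lmuNorm μ w).toReal) hμ (by positivity)
    (hu.1.1.sub hw.1.1) ?_
  filter_upwards [hu.ae_le, hw.ae_le] with p h1 h2
  refine (norm_sub_le _ _).trans ?_
  rw [add_mul]
  exact add_le_add h1 h2

theorem ae_eq_zero_of_lmuNorm_eq_zero {μ : ℝ} {u : R3 → ℂ} (h : lmuNorm μ u = 0) :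
    ∀ᵐ p, u p = 0 := by
  have h1 : lmuNorm μ u ≤ ENNReal.ofReal 0 := by simp [h]
  filter_upwards [(lmuNorm_le_ofReal_iff le_rfl).1 h1] with p hp
  rw [zero_mul] at hp
  exact norm_le_zero_iff.1 hp

theorem lmuNorm_congr_ae {μ : ℝ} {u w : R3 → ℂ} (h : u =ᵐ[volume] w) :
    lmuNorm μ u = lmuNorm μ w := by
  refine essSup_congr_ae ?_
  filter_upwards [h] with p hp
  rw [hp]

theorem ae_comp_add_left {P : R3 → Prop} (h : ∀ᵐ x, P x) (p : R3) : ∀ᵐ ξ, P (p + ξ) :=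
  (measurePreserving_add_left volume p).quasiMeasurePreserving.ae h

theorem ae_comp_neg {P : R3 → Prop} (h : ∀ᵐ x, P x) : ∀ᵐ ξ, P (-ξ) :=
  (Measure.measurePreserving_neg (volume : Measure R3)).quasiMeasurePreserving.ae h

theorem faddeevIntegrand_eq (v : R3 → ℂ) (k : C3) (U : R3 → ℂ) (p ξ : R3) :
    faddeevIntegrand v k U p ξ = v (p + ξ) * U (-ξ) * (denom k ξ)⁻¹ := div_eq_mul_inv _ _

theorem aestronglyMeasurable_comp_add_left {v : R3 → ℂ} (hv : AEStronglyMeasurable v volume)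
    (p : R3) : AEStronglyMeasurable (fun ξ => v (p + ξ)) volume :=
  hv.comp_measurePreserving (measurePreserving_add_left volume p)

theorem aestronglyMeasurable_comp_neg {v : R3 → ℂ} (hv : AEStronglyMeasurable v volume) :
    AEStronglyMeasurable (fun ξ => v (-ξ)) volume :=
  hv.comp_measurePreserving (Measure.measurePreserving_neg volume)

section Bounds

variable {μ : ℝ} {v U : R3 → ℂ} {k : C3} {A B c : ℝ}

theorem ae_norm_mul_le (hA : 0 ≤ A) (hvb : ∀ᵐ p, ‖v p‖ ≤ A * decay μ p)
    (hUb : ∀ᵐ p, ‖U p‖ ≤ B * decay μ p) (p : R3) :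
    ∀ᵐ ξ, ‖v (p + ξ) * U (-ξ)‖ ≤ A * B * (decay μ (p + ξ) * decay μ ξ) := by
  filter_upwards [ae_comp_add_left hvb p, ae_comp_neg hUb] with ξ h1 h2
  rw [norm_mul]
  rw [decay_neg] at h2
  refine (mul_le_mul h1 h2 (norm_nonneg _)
    (mul_nonneg hA (decay_pos μ (p + ξ)).le)).trans (le_of_eq ?_)
  ring

theorem lintegral_enorm_faddeevIntegrand_le (hA : 0 ≤ A) (hB : 0 ≤ B)
    (hvb : ∀ᵐ p, ‖v p‖ ≤ A * decay μ p) (hUb : ∀ᵐ p, ‖U p‖ ≤ B * decay μ p)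
    (hk : KernelBound μ k c) (p : R3) :
    ∫⁻ ξ, ‖faddeevIntegrand v k U p ξ‖ₑ ≤ ENNReal.ofReal (c * A * B * decay μ p) := by
  calc _ ≤ ∫⁻ ξ, ENNReal.ofReal (A * B) *
          (ENNReal.ofReal (decay μ (p + ξ) * decay μ ξ) * ‖(denom k ξ)⁻¹‖ₑ) := by
        refine lintegral_mono_ae ?_
        filter_upwards [ae_norm_mul_le hA hvb hUb p] with ξ h
        rw [faddeevIntegrand_eq, enorm_mul, ← mul_assoc, ← ENNReal.ofReal_mul (by positivity)]
        gcongr 1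
        rw [← ofReal_norm]
        exact ENNReal.ofReal_le_ofReal h
    _ ≤ ENNReal.ofReal (A * B) * ENNReal.ofReal (c * decay μ p) := by
        rw [lintegral_const_mul' _ _ ENNReal.ofReal_ne_top]
        gcongr 1
        exact hk p
    _ = _ := by
        rw [← ENNReal.ofReal_mul (by positivity)]
        congr 1
        ring

theorem aestronglyMeasurable_faddeevIntegrand (hv : AEStronglyMeasurable v volume)
    (hU : AEStronglyMeasurable U volume) (k : C3) (p : R3) :
    AEStronglyMeasurable (faddeevIntegrand v k U p) volume := by
  have : AEStronglyMeasurable (fun ξ => v (p + ξ) * U (-ξ) * (denom k ξ)⁻¹) volume :=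
    ((aestronglyMeasurable_comp_add_left hv p).mul (aestronglyMeasurable_comp_neg hU)).mul
      (measurable_denom k).inv.aestronglyMeasurable
  exact this.congr (Eventually.of_forall fun ξ => (faddeevIntegrand_eq v k U p ξ).symm)

theorem integrable_faddeevIntegrand (hv : MemLmu μ v) (hU : MemLmu μ U)
    (hk : KernelBound μ k c) (p : R3) : Integrable (faddeevIntegrand v k U p) volume :=
  ⟨aestronglyMeasurable_faddeevIntegrand hv.1.1 hU.1.1 k p,
    (lintegral_enorm_faddeevIntegrand_le ENNReal.toReal_nonneg ENNReal.toReal_nonneg hv.ae_le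
      hU.ae_le hk p).trans_lt ENNReal.ofReal_lt_top⟩

theorem norm_faddeevOp_le (hA : 0 ≤ A) (hB : 0 ≤ B) (hc : 0 ≤ c)
    (hvb : ∀ᵐ p, ‖v p‖ ≤ A * decay μ p) (hUb : ∀ᵐ p, ‖U p‖ ≤ B * decay μ p)
    (hk : KernelBound μ k c) (p : R3) : ‖faddeevOp v k U p‖ ≤ c * A * B * decay μ p := by
  have h := (enorm_integral_le_lintegral_enorm _).trans
    (lintegral_enorm_faddeevIntegrand_le hA hB hvb hUb hk p)
  have hd := decay_pos μ p
  rw [← ofReal_norm, ENNReal.ofReal_le_ofReal_iff (by positivity)] at h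
  exact h

/-- A kernel bound is a bound for the operator norm. -/
theorem lmuNorm_faddeevOp_le (hc : 0 ≤ c) (hv : MemLmu μ v) (hU : MemLmu μ U)
    (hk : KernelBound μ k c) :
    lmuNorm μ (faddeevOp v k U) ≤ ENNReal.ofReal c * lmuNorm μ v * lmuNorm μ U := by
  rw [← ENNReal.ofReal_toReal hv.2.ne, ← ENNReal.ofReal_toReal hU.2.ne, ← ENNReal.ofReal_mul hc,
    ← ENNReal.ofReal_mul (by positivity), lmuNorm_le_ofReal_iff (by positivity)]
  exact Eventually.of_forall (norm_faddeevOp_le ENNReal.toReal_nonneg ENNReal.toReal_nonneg hc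
    hv.ae_le hU.ae_le hk)

theorem faddeevOp_sub {W : R3 → ℂ} (hv : MemLmu μ v) (hU : MemLmu μ U) (hW : MemLmu μ W)
    (hk : KernelBound μ k c) (p : R3) :
    faddeevOp v k (fun ξ => U ξ - W ξ) p = faddeevOp v k U p - faddeevOp v k W p := by
  unfold faddeevOp
  rw [← integral_sub (integrable_faddeevIntegrand hv hU hk p)
    (integrable_faddeevIntegrand hv hW hk p)]
  refine integral_congr_ae (Eventually.of_forall fun ξ => ?_)
  simp only [faddeevIntegrand_eq]
  ring

end Bounds

/-! ### Joint continuity of `A(k) U(k)` -/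

theorem integrable_decay_mul_decay {μ : ℝ} (hμ : 2 ≤ μ) :
    Integrable (fun ξ : R3 => decay μ ξ * decay μ ξ) volume := by
  have h := integrable_one_add_norm (E := R3) (μ := volume) (r := 4)
    (by rw [finrank_euclideanSpace, Fintype.card_fin]; norm_num)
  refine h.mono' ((continuous_decay μ).mul (continuous_decay μ)).aestronglyMeasurable
    (Eventually.of_forall fun ξ => ?_)
  have h1 := decay_le hμ ξ
  have h0 := decay_pos μ ξ
  rw [Real.norm_of_nonneg (by positivity)]
  calc decay μ ξ * decay μ ξ ≤ ((1 + ‖ξ‖) ^ 2)⁻¹ * ((1 + ‖ξ‖) ^ 2)⁻¹ := by gcongr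
    _ = (1 + ‖ξ‖) ^ (-4 : ℝ) := by
      rw [Real.rpow_neg (by positivity), ← mul_inv, ← pow_add]
      norm_cast

theorem memLp_two_decay {μ : ℝ} (hμ : 2 ≤ μ) : MemLp (decay μ) 2 (volume : Measure R3) := by
  rw [memLp_two_iff_integrable_sq (continuous_decay μ).aestronglyMeasurable]
  simpa only [pow_two] using integrable_decay_mul_decay hμ

theorem memLp_two_of_ae_le {μ A : ℝ} (hμ : 2 ≤ μ) {v : R3 → ℂ}
    (hv : AEStronglyMeasurable v volume) (hvb : ∀ᵐ p, ‖v p‖ ≤ A * decay μ p) :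
    MemLp v 2 volume :=
  ((memLp_two_decay hμ).const_mul A).mono' hv hvb

/-- Translations act continuously on `L²`. -/
theorem tendsto_eLpNorm_translate_sub {v : R3 → ℂ} (hv : MemLp v 2 volume) (p₀ : R3) :
    Tendsto (fun p => eLpNorm (fun ξ => v (p + ξ) - v (p₀ + ξ)) 2 volume) (𝓝 p₀) (𝓝 0) := by
  set g : C(R3, C(R3, R3)) := ContinuousMap.curry ⟨fun z : R3 × R3 => z.1 + z.2, by fun_prop⟩
  have hg : ∀ p, MeasurePreserving (g p) volume volume := fun p =>
    measurePreserving_add_left volume p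
  have h := Filter.Tendsto.compMeasurePreservingLp (l := 𝓝 p₀) (f := fun _ => hv.toLp v)
    (g := fun p => g p) tendsto_const_nhds (g.continuous.tendsto p₀) hg (hg p₀) (by simp)
  rw [tendsto_iff_edist_tendsto_0] at h
  refine h.congr fun p => ?_
  rw [Lp.toLp_compMeasurePreserving, Lp.toLp_compMeasurePreserving, Lp.edist_toLp_toLp]
  rfl

theorem lintegral_enorm_mul_decay_le {μ : ℝ} {h : R3 → ℂ} (hh : AEStronglyMeasurable h volume) :
    ∫⁻ ξ, ‖h ξ‖ₑ * ‖decay μ ξ‖ₑ ≤ eLpNorm h 2 volume * eLpNorm (decay μ) 2 volume := by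
  have e := ENNReal.lintegral_mul_le_Lp_mul_Lq (volume : Measure R3) Real.HolderConjugate.two_two
    (f := fun ξ => ‖h ξ‖ₑ) (g := fun ξ => ‖decay μ ξ‖ₑ) hh.enorm
    (continuous_decay μ).aestronglyMeasurable.enorm
  rw [eLpNorm_eq_lintegral_rpow_enorm_toReal (by simp) (by simp),
    eLpNorm_eq_lintegral_rpow_enorm_toReal (by simp) (by simp)]
  simpa only [Pi.mul_apply, ENNReal.toReal_ofNat] using e

/-- A continuous bounded substitute for `d⁻¹`, equal to it for `|d| ≥ δ`. -/
noncomputable def truncInv (δ : ℝ) (d : ℂ) : ℂ :=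
  (starRingEnd ℂ) d * ((((max ‖d‖ δ) ^ 2)⁻¹ : ℝ) : ℂ)

theorem continuous_truncInv {δ : ℝ} (hδ : 0 < δ) : Continuous (truncInv δ) := by
  unfold truncInv
  refine Complex.continuous_conj.mul (Complex.continuous_ofReal.comp ?_)
  refine Continuous.inv₀ (by fun_prop) fun d => ?_
  have : 0 < max ‖d‖ δ := lt_max_of_lt_right hδ
  positivity

theorem norm_truncInv {δ : ℝ} (d : ℂ) : ‖truncInv δ d‖ = ‖d‖ * ((max ‖d‖ δ) ^ 2)⁻¹ := by
  rw [truncInv, norm_mul, RCLike.norm_conj, Complex.norm_real, Real.norm_of_nonneg (by positivity)]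

theorem norm_truncInv_le {δ : ℝ} (hδ : 0 < δ) (d : ℂ) : ‖truncInv δ d‖ ≤ δ⁻¹ := by
  rw [norm_truncInv]
  have hm : 0 < max ‖d‖ δ := lt_max_of_lt_right hδ
  calc ‖d‖ * ((max ‖d‖ δ) ^ 2)⁻¹ ≤ max ‖d‖ δ * ((max ‖d‖ δ) ^ 2)⁻¹ := by
        gcongr
        exact le_max_left _ _
    _ = (max ‖d‖ δ)⁻¹ := by field_simp
    _ ≤ δ⁻¹ := inv_anti₀ hδ (le_max_right _ _)

theorem inv_eq_conj_mul (d : ℂ) : d⁻¹ = (starRingEnd ℂ) d * (((‖d‖ ^ 2)⁻¹ : ℝ) : ℂ) := by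
  rw [Complex.inv_def, Complex.normSq_eq_norm_sq]

theorem norm_inv_sub_truncInv_le {δ : ℝ} (hδ : 0 < δ) (d : ℂ) :
    ‖d⁻¹ - truncInv δ d‖ₑ ≤ {d : ℂ | ‖d‖ ≤ δ}.indicator (fun d => ‖d⁻¹‖ₑ) d := by
  by_cases hd : ‖d‖ ≤ δ
  · rw [Set.indicator_of_mem (by exact hd), ← ofReal_norm, ← ofReal_norm]
    refine ENNReal.ofReal_le_ofReal ?_
    rcases eq_or_ne d 0 with rfl | h0
    · simp [truncInv]
    have hpos : 0 < ‖d‖ := norm_pos_iff.2 h0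
    have hle : (δ ^ 2)⁻¹ ≤ (‖d‖ ^ 2)⁻¹ := inv_anti₀ (by positivity) (by gcongr)
    rw [truncInv, inv_eq_conj_mul, max_eq_right hd, ← mul_sub, norm_mul, norm_mul,
      ← Complex.ofReal_sub, Complex.norm_real, Complex.norm_real,
      Real.norm_of_nonneg (sub_nonneg.2 hle), Real.norm_of_nonneg (by positivity)]
    gcongr
    exact sub_le_self _ (by positivity)
  · rw [Set.indicator_of_notMem (by exact hd), truncInv, max_eq_left (le_of_not_ge hd),
      ← inv_eq_conj_mul, sub_self, enorm_zero]

section Continuity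

variable {μ A B : ℝ} {v : R3 → ℂ} {S : Set C3} {U : C3 → R3 → ℂ}

theorem measurable_truncInv_denom {δ : ℝ} (hδ : 0 < δ) (k : C3) :
    Measurable fun ξ => truncInv δ (denom k ξ) :=
  (continuous_truncInv hδ).measurable.comp (measurable_denom k)

theorem integrable_mul_truncInv (hμ : 2 ≤ μ) {w U : R3 → ℂ}
    (hw : MemLp w 2 volume) (hU : AEStronglyMeasurable U volume)
    (hUb : ∀ᵐ ξ, ‖U ξ‖ ≤ B * decay μ ξ) {δ : ℝ} (hδ : 0 < δ) (k : C3) :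
    Integrable (fun ξ => w ξ * (U (-ξ) * truncInv δ (denom k ξ))) volume := by
  refine hw.integrable_mul (q := 2) ?_
  refine ((memLp_two_decay hμ).const_mul (B * δ⁻¹)).mono'
    ((aestronglyMeasurable_comp_neg hU).mul
      (measurable_truncInv_denom hδ k).aestronglyMeasurable) ?_
  filter_upwards [ae_comp_neg hUb] with ξ h
  rw [decay_neg] at h
  rw [norm_mul]
  have h1 := norm_truncInv_le hδ (denom k ξ)
  calc _ ≤ B * decay μ ξ * δ⁻¹ :=
        mul_le_mul h h1 (norm_nonneg _) ((norm_nonneg _).trans h)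
    _ = _ := by ring

/-- With the truncated denominator, `A(k) U(k)` is jointly continuous: the translates of `v̂` move
continuously in `L²`, and the other factor converges pointwise under a fixed bound. -/
theorem continuousOn_integral_truncInv (hμ : 2 ≤ μ) (hB : 0 ≤ B) (hv : AEStronglyMeasurable v volume)
    (hvb : ∀ᵐ p, ‖v p‖ ≤ A * decay μ p)
    (hUm : ∀ k ∈ S, AEStronglyMeasurable (U k) volume)
    (hUb : ∀ k ∈ S, ∀ᵐ ξ, ‖U k ξ‖ ≤ B * decay μ ξ)
    (hUc : ∀ ξ, ContinuousOn (fun k => U k ξ) S) {δ : ℝ} (hδ : 0 < δ) :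
    ContinuousOn (fun q : C3 × R3 => ∫ ξ, v (q.2 + ξ) * (U q.1 (-ξ) * truncInv δ (denom q.1 ξ)))
      (S ×ˢ Set.univ) := by
  rintro ⟨k₀, p₀⟩ ⟨hk₀, -⟩
  have hk₀ : k₀ ∈ S := hk₀
  have hv2 := memLp_two_of_ae_le hμ hv hvb
  have hvt : ∀ p, MemLp (fun ξ => v (p + ξ)) 2 volume := fun p =>
    hv2.comp_measurePreserving (measurePreserving_add_left volume p)
  set l := 𝓝[S ×ˢ Set.univ] (k₀, p₀) with hl
  have hS : ∀ᶠ q : C3 × R3 in l, q.1 ∈ S :=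
    eventually_mem_nhdsWithin.mono fun q hq => hq.1
  have hfst : Tendsto (fun q : C3 × R3 => q.1) l (𝓝[S] k₀) :=
    tendsto_nhdsWithin_iff.2 ⟨continuous_fst.continuousAt.mono_left nhdsWithin_le_nhds, hS⟩
  have hsnd : Tendsto (fun q : C3 × R3 => q.2) l (𝓝 p₀) :=
    (continuous_snd.tendsto (k₀, p₀)).mono_left nhdsWithin_le_nhds
  have hbound : ∀ k ∈ S, ∀ᵐ ξ, ‖U k (-ξ) * truncInv δ (denom k ξ)‖ ≤ B * δ⁻¹ * decay μ ξ := by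
    intro k hk
    filter_upwards [ae_comp_neg (hUb k hk)] with ξ h
    rw [decay_neg] at h
    rw [norm_mul]
    calc _ ≤ B * decay μ ξ * δ⁻¹ :=
          mul_le_mul h (norm_truncInv_le hδ _) (norm_nonneg _) ((norm_nonneg _).trans h)
      _ = _ := by ring
  have hmeas : ∀ k ∈ S, AEStronglyMeasurable (fun ξ => U k (-ξ) * truncInv δ (denom k ξ)) volume :=
    fun k hk => (aestronglyMeasurable_comp_neg (hUm k hk)).mul
      (measurable_truncInv_denom hδ k).aestronglyMeasurable
  have hfix : Tendsto (fun q : C3 × R3 =>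
      ∫ ξ, v (p₀ + ξ) * (U q.1 (-ξ) * truncInv δ (denom q.1 ξ))) l
      (𝓝 (∫ ξ, v (p₀ + ξ) * (U k₀ (-ξ) * truncInv δ (denom k₀ ξ)))) := by
    refine tendsto_integral_filter_of_dominated_convergence
      (fun ξ => ‖v (p₀ + ξ)‖ * (B * δ⁻¹ * decay μ ξ)) ?_ ?_ ?_ ?_
    · filter_upwards [hS] with q hq
      exact (hvt p₀).1.mul (hmeas q.1 hq)
    · filter_upwards [hS] with q hq
      filter_upwards [hbound q.1 hq] with ξ h
      rw [norm_mul]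
      gcongr
    · exact (hvt p₀).norm.integrable_mul ((memLp_two_decay hμ).const_mul _)
    · refine Eventually.of_forall fun ξ => Tendsto.mul tendsto_const_nhds (Tendsto.mul ?_ ?_)
      · exact (hUc (-ξ) k₀ hk₀).tendsto.comp hfst
      · have hc : Continuous fun k => truncInv δ (denom k ξ) := by
          refine (continuous_truncInv hδ).comp ?_
          unfold denom bilin
          fun_prop
        exact ((hc.tendsto k₀).mono_left nhdsWithin_le_nhds).comp hfst
  have hmove : Tendsto (fun q : C3 × R3 =>
      ∫ ξ, (v (q.2 + ξ) - v (p₀ + ξ)) * (U q.1 (-ξ) * truncInv δ (denom q.1 ξ))) l (𝓝 0) := by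
    rw [tendsto_zero_iff_enorm_tendsto_zero]
    have hlim : Tendsto (fun q : C3 × R3 => ENNReal.ofReal (B * δ⁻¹) *
        (eLpNorm (fun ξ => v (q.2 + ξ) - v (p₀ + ξ)) 2 volume * eLpNorm (decay μ) 2 volume))
        l (𝓝 0) := by
      have h1 := (tendsto_eLpNorm_translate_sub hv2 p₀).comp hsnd
      have h2 := ENNReal.Tendsto.mul_const h1 (Or.inr (memLp_two_decay hμ).2.ne)
      have h3 := ENNReal.Tendsto.const_mul h2
        (Or.inr (ENNReal.ofReal_ne_top : ENNReal.ofReal (B * δ⁻¹) ≠ ⊤))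
      simpa using h3
    refine tendsto_of_tendsto_of_tendsto_of_le_of_le' tendsto_const_nhds hlim
      (Eventually.of_forall fun _ => zero_le) ?_
    filter_upwards [hS] with q hq
    refine (enorm_integral_le_lintegral_enorm _).trans ?_
    calc _ ≤ ∫⁻ ξ, ENNReal.ofReal (B * δ⁻¹) * (‖v (q.2 + ξ) - v (p₀ + ξ)‖ₑ * ‖decay μ ξ‖ₑ) := by
          refine lintegral_mono_ae ?_
          filter_upwards [hbound q.1 hq] with ξ h
          rw [enorm_mul, mul_left_comm, Real.enorm_of_nonneg (decay_pos μ ξ).le,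
            ← ENNReal.ofReal_mul (by positivity)]
          gcongr 1
          rw [← ofReal_norm]
          exact ENNReal.ofReal_le_ofReal h
      _ ≤ _ := by
          rw [lintegral_const_mul' _ _ ENNReal.ofReal_ne_top]
          gcongr 1
          exact lintegral_enorm_mul_decay_le ((hvt _).1.sub (hvt _).1)
  have hsum := hmove.add hfix
  rw [zero_add] at hsum
  refine hsum.congr' ?_
  filter_upwards [hS] with q hq
  rw [← integral_add]
  · refine integral_congr_ae (Eventually.of_forall fun ξ => ?_)
    simp only
    ring
  · exact integrable_mul_truncInv hμ ((hvt q.2).sub (hvt p₀)) (hUm _ hq) (hUb _ hq) hδ _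
  · exact integrable_mul_truncInv hμ (hvt p₀) (hUm _ hq) (hUb _ hq) hδ _

/-- Joint continuity of `(k, p) ↦ (A(k) U(k))(p)`: by `lintegral_indicator_denom_le`, the error made
by truncating the denominator is small uniformly in `k` and `p`. -/
theorem continuousOn_faddeevOp (hμ : 2 ≤ μ) (hA : 0 ≤ A) (hB : 0 ≤ B)
    (hv : AEStronglyMeasurable v volume) (hvb : ∀ᵐ p, ‖v p‖ ≤ A * decay μ p)
    (hSσ : S ⊆ sigmaSet) {c : C3 → ℝ} (hc : ∀ k ∈ S, KernelBound μ k (c k))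
    (hUm : ∀ k ∈ S, AEStronglyMeasurable (U k) volume)
    (hUb : ∀ k ∈ S, ∀ᵐ ξ, ‖U k ξ‖ ≤ B * decay μ ξ)
    (hUc : ∀ ξ, ContinuousOn (fun k => U k ξ) S) :
    ContinuousOn (fun q : C3 × R3 => faddeevOp v q.1 (U q.1) q.2) (S ×ˢ Set.univ) := by
  have hv2 := memLp_two_of_ae_le hμ hv hvb
  have herr : ∀ δ > 0, ∀ q ∈ S ×ˢ (Set.univ : Set R3),
      edist (faddeevOp v q.1 (U q.1) q.2)
        (∫ ξ, v (q.2 + ξ) * (U q.1 (-ξ) * truncInv δ (denom q.1 ξ))) ≤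
      ENNReal.ofReal (A * B) * (ENNReal.ofReal (3 * Real.pi * √(3 / 2 * δ)) * rieszConst) := by
    rintro δ hδ ⟨k, p⟩ ⟨hk, -⟩
    have hk : k ∈ S := hk
    simp only
    have hi1 : Integrable (faddeevIntegrand v k (U k) p) volume :=
      integrable_faddeevIntegrand (memLmu_of_ae_le hμ hA hv hvb)
        (memLmu_of_ae_le hμ hB (hUm k hk) (hUb k hk)) (hc k hk) p
    have hi2 : Integrable (fun ξ => v (p + ξ) * (U k (-ξ) * truncInv δ (denom k ξ))) volume :=
      integrable_mul_truncInv hμ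
      (hv2.comp_measurePreserving (measurePreserving_add_left volume p)) (hUm k hk) (hUb k hk) hδ k
    rw [edist_eq_enorm_sub, faddeevOp, ← integral_sub hi1 hi2]
    refine (enorm_integral_le_lintegral_enorm _).trans ?_
    calc _ ≤ ∫⁻ ξ, ENNReal.ofReal (A * B) *
            {ξ : R3 | ‖denom k ξ‖ ≤ δ}.indicator (fun ξ => ‖(denom k ξ)⁻¹‖ₑ) ξ := by
          refine lintegral_mono_ae ?_
          filter_upwards [ae_norm_mul_le hA hvb (hUb k hk) p] with ξ h
          have e : faddeevIntegrand v k (U k) p ξ - v (p + ξ) *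
              (U k (-ξ) * truncInv δ (denom k ξ)) =
              v (p + ξ) * U k (-ξ) * ((denom k ξ)⁻¹ - truncInv δ (denom k ξ)) := by
            rw [faddeevIntegrand_eq]
            ring
          rw [e, enorm_mul]
          refine mul_le_mul' ?_ (norm_inv_sub_truncInv_le hδ (denom k ξ))
          rw [← ofReal_norm]
          refine ENNReal.ofReal_le_ofReal (h.trans (mul_le_of_le_one_right (by positivity) ?_))
          exact mul_le_one₀ (decay_le_one hμ _) (decay_pos μ ξ).le (decay_le_one hμ _)
      _ ≤ _ := by
          rw [lintegral_const_mul' _ _ ENNReal.ofReal_ne_top]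
          gcongr 1
          exact lintegral_indicator_denom_le (hSσ hk) hδ
  have hzero : Tendsto (fun δ : ℝ => ENNReal.ofReal (A * B) *
      (ENNReal.ofReal (3 * Real.pi * √(3 / 2 * δ)) * rieszConst)) (𝓝[>] 0) (𝓝 0) := by
    have h1 : Tendsto (fun δ : ℝ => ENNReal.ofReal (3 * Real.pi * √(3 / 2 * δ))) (𝓝[>] 0)
        (𝓝 0) := by
      have hc : Continuous fun δ : ℝ => ENNReal.ofReal (3 * Real.pi * √(3 / 2 * δ)) :=
        ENNReal.continuous_ofReal.comp (by fun_prop)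
      have := (hc.tendsto 0).mono_left (nhdsWithin_le_nhds (s := Set.Ioi 0))
      simpa using this
    have h2 := ENNReal.Tendsto.mul_const h1 (Or.inr rieszConst_lt_top.ne)
    have h3 := ENNReal.Tendsto.const_mul h2
      (Or.inr (ENNReal.ofReal_ne_top : ENNReal.ofReal (A * B) ≠ ⊤))
    simpa using h3
  refine continuousOn_of_uniform_approx_of_continuousOn fun u hu => ?_
  obtain ⟨ε, hε, hεu⟩ := _root_.mem_uniformity_edist.1 hu
  obtain ⟨δ, hδε, hδ⟩ := ((hzero.eventually (gt_mem_nhds hε)).and self_mem_nhdsWithin).exists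
  exact ⟨_, continuousOn_integral_truncInv hμ hB hv hvb hUm hUb hUc hδ,
    fun q hq => hεu ((herr δ hδ q hq).trans_lt hδε)⟩

end Continuity

/-! ### Successive approximations -/

section FixedParameter

variable {μ C c : ℝ} {v U : R3 → ℂ} {k : C3}

theorem continuous_faddeevOp (hμ : 2 ≤ μ) (hv : MemLmu μ v) (hU : MemLmu μ U)
    (hkσ : k ∈ sigmaSet) (hk : KernelBound μ k c) : Continuous (faddeevOp v k U) := by
  have h := continuousOn_faddeevOp (S := {k}) (U := fun _ => U) (c := fun _ => c) hμ
    ENNReal.toReal_nonneg ENNReal.toReal_nonneg hv.1.1 hv.ae_le (Set.singleton_subset_iff.2 hkσ)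
    (by rintro _ rfl; exact hk) (fun _ _ => hU.1.1) (fun _ _ => hU.ae_le)
    (fun _ => continuousOn_const)
  have h2 := h.comp_continuous (f := fun p : R3 => (k, p)) (by fun_prop) (fun p => ⟨rfl, trivial⟩)
  exact h2

theorem memLmu_faddeevOp (hμ : 2 ≤ μ) (hc : 0 ≤ c) (hv : MemLmu μ v) (hU : MemLmu μ U)
    (hkσ : k ∈ sigmaSet) (hk : KernelBound μ k c) : MemLmu μ (faddeevOp v k U) :=
  memLmu_of_ae_le hμ (by positivity) (continuous_faddeevOp hμ hv hU hkσ hk).aestronglyMeasurable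
    (Eventually.of_forall (norm_faddeevOp_le ENNReal.toReal_nonneg ENNReal.toReal_nonneg hc
      hv.ae_le hU.ae_le hk))

theorem memLmu_faddeevStep (hμ : 2 ≤ μ) (hc : 0 ≤ c) (hv : MemLmu μ v) (hU : MemLmu μ U)
    (hkσ : k ∈ sigmaSet) (hk : KernelBound μ k c) : MemLmu μ (faddeevStep v k U) :=
  hv.sub hμ (memLmu_faddeevOp hμ hc hv hU hkσ hk)

theorem memLmu_iterate_faddeevStep (hμ : 2 ≤ μ) (hc : 0 ≤ c) (hv : MemLmu μ v)
    (hU : MemLmu μ U) (hkσ : k ∈ sigmaSet) (hk : KernelBound μ k c) (n : ℕ) :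
    MemLmu μ ((faddeevStep v k)^[n] U) := by
  induction n with
  | zero => exact hU
  | succ n ih =>
    rw [Function.iterate_succ_apply']
    exact memLmu_faddeevStep hμ hc hv ih hkσ hk

/-- The step of the iteration contracts the distance to a fixed point. -/
theorem lmuNorm_faddeevStep_sub_le {H : R3 → ℂ} (hc : 0 ≤ c) (hv : MemLmu μ v)
    (hvC : lmuNorm μ v ≤ ENNReal.ofReal C) (hk : KernelBound μ k c) (hU : MemLmu μ U)
    (hH : MemLmu μ H) (hfix : ∀ p, H p = v p - faddeevOp v k H p) (hμ : 2 ≤ μ) :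
    lmuNorm μ (fun p => faddeevStep v k U p - H p) ≤
      ENNReal.ofReal (c * C) * lmuNorm μ (fun p => U p - H p) := by
  have e : ∀ p, ‖faddeevStep v k U p - H p‖ = ‖faddeevOp v k (fun ξ => U ξ - H ξ) p‖ := by
    intro p
    rw [faddeevOp_sub hv hU hH hk, hfix p, faddeevStep, sub_sub_sub_cancel_left, norm_sub_rev]
  have e2 : lmuNorm μ (fun p => faddeevStep v k U p - H p) =
      lmuNorm μ (faddeevOp v k (fun ξ => U ξ - H ξ)) := by
    simp only [lmuNorm, e]
  rw [e2, ENNReal.ofReal_mul hc]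
  refine (lmuNorm_faddeevOp_le hc hv (hU.sub hμ hH) hk).trans ?_
  gcongr

/-- The solution of the Faddeev equation as the pointwise limit of the iterates started at `v̂`. -/
noncomputable def faddeevSol (v : R3 → ℂ) (k : C3) (p : R3) : ℂ :=
  limUnder atTop fun n : ℕ => (faddeevStep v k)^[n] v p

theorem norm_iterate_succ_sub_le (hμ : 2 ≤ μ) (hc : 0 ≤ c) (hC : 0 ≤ C) (hv : MemLmu μ v)
    (hvb : ∀ᵐ p, ‖v p‖ ≤ C * decay μ p) (hkσ : k ∈ sigmaSet) (hk : KernelBound μ k c) (n : ℕ) :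
    ∀ p, ‖(faddeevStep v k)^[n + 1] v p - (faddeevStep v k)^[n] v p‖ ≤
      c * C * C * decay μ p * (c * C) ^ n := by
  induction n with
  | zero =>
    intro p
    have h := norm_faddeevOp_le hC hC hc hvb hvb hk p
    simpa [faddeevStep] using h
  | succ n ih =>
    intro p
    have hm := memLmu_iterate_faddeevStep hμ hc hv hv hkσ hk
    have e : ∀ m, (faddeevStep v k)^[m + 1] v p =
        v p - faddeevOp v k ((faddeevStep v k)^[m] v) p := fun m => by
      rw [Function.iterate_succ_apply', faddeevStep]
    rw [e (n + 1), e n, sub_sub_sub_cancel_left, norm_sub_rev, ← faddeevOp_sub hv (hm _) (hm _) hk]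
    refine (norm_faddeevOp_le (B := c * C * C * (c * C) ^ n) hC (by positivity) hc hvb
      (Eventually.of_forall fun ξ => (ih ξ).trans (le_of_eq ?_)) hk p).trans (le_of_eq ?_) <;> ring

variable (hμ : 2 ≤ μ) (hc : 0 ≤ c) (hC : 0 ≤ C) (hv : MemLmu μ v)
  (hvb : ∀ᵐ p, ‖v p‖ ≤ C * decay μ p) (hkσ : k ∈ sigmaSet) (hk : KernelBound μ k c)
  (hr : c * C < 1)

include hμ hc hC hv hvb hkσ hk hr

theorem tendsto_iterate_faddeevSol (p : R3) :
    Tendsto (fun n : ℕ => (faddeevStep v k)^[n] v p) atTop (𝓝 (faddeevSol v k p)) := by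
  refine tendsto_nhds_limUnder (cauchySeq_tendsto_of_complete
    (cauchySeq_of_le_geometric (c * C) (c * C * C * decay μ p) hr fun n => ?_))
  rw [dist_comm, dist_eq_norm]
  exact norm_iterate_succ_sub_le hμ hc hC hv hvb hkσ hk n p

theorem norm_iterate_sub_faddeevSol_le (n : ℕ) (p : R3) :
    ‖(faddeevStep v k)^[n] v p - faddeevSol v k p‖ ≤
      c * C * C * decay μ p * (c * C) ^ n / (1 - c * C) := by
  rw [← dist_eq_norm]
  refine dist_le_of_le_geometric_of_tendsto (c * C) (c * C * C * decay μ p) hr (fun n => ?_)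
    (tendsto_iterate_faddeevSol hμ hc hC hv hvb hkσ hk hr p) n
  rw [dist_comm, dist_eq_norm]
  exact norm_iterate_succ_sub_le hμ hc hC hv hvb hkσ hk n p

theorem norm_faddeevSol_sub_le (p : R3) :
    ‖faddeevSol v k p - v p‖ ≤ c * C * C / (1 - c * C) * decay μ p := by
  have h := norm_iterate_sub_faddeevSol_le hμ hc hC hv hvb hkσ hk hr 0 p
  rw [norm_sub_rev]
  refine h.trans (le_of_eq ?_)
  rw [pow_zero]
  ring

theorem ae_norm_faddeevSol_le : ∀ᵐ p, ‖faddeevSol v k p‖ ≤ C / (1 - c * C) * decay μ p := by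
  filter_upwards [hvb] with p hp
  have h := norm_faddeevSol_sub_le hμ hc hC hv hvb hkσ hk hr p
  have h1 := norm_le_norm_add_norm_sub' (faddeevSol v k p) (v p)
  have h2 : C / (1 - c * C) * decay μ p = C * decay μ p + c * C * C / (1 - c * C) * decay μ p := by
    have : 1 - c * C ≠ 0 := by linarith
    rw [← add_mul]
    congr 1
    rw [div_eq_iff this, add_mul, div_mul_cancel₀ _ this]
    ring
  rw [h2]
  linarith

theorem memLmu_faddeevSol : MemLmu μ (faddeevSol v k) := by
  have hr' : 0 < 1 - c * C := by linarith
  refine memLmu_of_ae_le hμ (div_nonneg hC hr'.le) ?_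
    (ae_norm_faddeevSol_le hμ hc hC hv hvb hkσ hk hr)
  exact aestronglyMeasurable_of_tendsto_ae atTop
    (fun n => (memLmu_iterate_faddeevStep hμ hc hv hv hkσ hk n).1.1)
    (Eventually.of_forall (tendsto_iterate_faddeevSol hμ hc hC hv hvb hkσ hk hr))

theorem faddeevSol_eq (p : R3) :
    faddeevSol v k p = v p - faddeevOp v k (faddeevSol v k) p := by
  have hr' : 0 < 1 - c * C := by linarith
  have hlim := tendsto_iterate_faddeevSol hμ hc hC hv hvb hkσ hk hr p
  refine tendsto_nhds_unique ((tendsto_add_atTop_iff_nat 1).2 hlim) ?_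
  simp only [Function.iterate_succ_apply']
  refine Tendsto.sub tendsto_const_nhds (tendsto_iff_norm_sub_tendsto_zero.2 ?_)
  refine squeeze_zero (g := fun n : ℕ => c * C * (c * C * C / (1 - c * C)) * decay μ p *
    (c * C) ^ n) (fun _ => norm_nonneg _) (fun n => ?_) ?_
  · rw [← faddeevOp_sub hv (memLmu_iterate_faddeevStep hμ hc hv hv hkσ hk n)
      (memLmu_faddeevSol hμ hc hC hv hvb hkσ hk hr) hk]
    refine (norm_faddeevOp_le (B := c * C * C * (c * C) ^ n / (1 - c * C)) hC (by positivity) hc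
      hvb (Eventually.of_forall fun ξ => (norm_iterate_sub_faddeevSol_le hμ hc hC hv hvb hkσ hk hr
        n ξ).trans (le_of_eq ?_)) hk p).trans (le_of_eq ?_) <;> ring
  · have := (tendsto_pow_atTop_nhds_zero_of_lt_one (mul_nonneg hc hC) hr).const_mul
      (c * C * (c * C * C / (1 - c * C)) * decay μ p)
    rwa [mul_zero] at this

end FixedParameter

section Family

variable {μ C q : ℝ} {v : R3 → ℂ} {S : Set C3} {c : C3 → ℝ}

/-- The iterates, minus `v̂`, are jointly continuous. -/
theorem continuousOn_iterate_sub (hμ : 2 ≤ μ) (hC : 0 ≤ C) (hv : MemLmu μ v)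
    (hvb : ∀ᵐ p, ‖v p‖ ≤ C * decay μ p) (hS : S ⊆ sigmaSet)
    (hc : ∀ k ∈ S, 0 ≤ c k) (hk : ∀ k ∈ S, KernelBound μ k (c k)) (hq : q < 1)
    (hcq : ∀ k ∈ S, c k * C ≤ q) (n : ℕ) :
    ContinuousOn (fun z : C3 × R3 => (faddeevStep v z.1)^[n] v z.2 - v z.2) (S ×ˢ Set.univ) := by
  rcases S.eq_empty_or_nonempty with rfl | ⟨k₀, hk₀⟩
  · simp
  have hq0 : 0 ≤ q := (mul_nonneg (hc k₀ hk₀) hC).trans (hcq k₀ hk₀)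
  have hq' : 0 < 1 - q := by linarith
  have hB : ∀ n : ℕ, ∀ k ∈ S, ∀ᵐ p, ‖(faddeevStep v k)^[n] v p‖ ≤ C / (1 - q) * decay μ p := by
    intro n k hkS
    have hCq : C ≤ C / (1 - q) := le_div_self hC hq' (by linarith)
    induction n with
    | zero =>
      filter_upwards [hvb] with p hp
      exact hp.trans (mul_le_mul_of_nonneg_right hCq (decay_pos μ p).le)
    | succ n ih =>
      filter_upwards [hvb] with p hp
      rw [Function.iterate_succ_apply', faddeevStep]
      have h := norm_faddeevOp_le hC (div_nonneg hC hq'.le) (hc k hkS) hvb ih (hk k hkS) p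
      have h2 : c k * C * (C / (1 - q)) * decay μ p ≤ q * (C / (1 - q)) * decay μ p := by
        have := decay_pos μ p
        gcongr
        exact hcq k hkS
      have h3 : C / (1 - q) * decay μ p = C * decay μ p + q * (C / (1 - q)) * decay μ p := by
        field_simp
        ring
      rw [h3]
      exact (norm_sub_le _ _).trans (add_le_add hp (h.trans h2))
  induction n with
  | zero => simpa using continuousOn_const
  | succ n ih =>
    have h := continuousOn_faddeevOp (U := fun k => (faddeevStep v k)^[n] v) hμ hC
      (div_nonneg hC hq'.le) hv.1.1 hvb hS hk
      (fun k hkS => (memLmu_iterate_faddeevStep hμ (hc k hkS) hv hv (hS hkS) (hk k hkS) n).1.1)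
      (hB n) (fun ξ => by
        have h1 := ih.comp (f := fun k : C3 => (k, ξ)) (s := S) (by fun_prop)
          (fun k hkS => ⟨hkS, trivial⟩)
        have h2 := h1.add (continuousOn_const (c := v ξ))
        refine h2.congr fun k _ => ?_
        simp)
    refine h.neg.congr fun z _ => ?_
    rw [Function.iterate_succ_apply', faddeevStep]
    simp

/-- Solution of the Faddeev equation on a set of parameters on which the operators `A(k)` are
uniformly contracting. -/
theorem uniquelySolvedBy_faddeevSol (hμ : 2 ≤ μ) (hC : 0 ≤ C) (hv : MemLmu μ v)
    (hvC : lmuNorm μ v ≤ ENNReal.ofReal C) (hS : S ⊆ sigmaSet)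
    (hc : ∀ k ∈ S, 0 ≤ c k) (hk : ∀ k ∈ S, KernelBound μ k (c k))
    (hr : ∀ k ∈ S, c k * C < 1) : UniquelySolvedBy μ v S (faddeevSol v) := by
  have hvb := (lmuNorm_le_ofReal_iff hC).1 hvC
  have hmem : ∀ k ∈ S, MemLmu μ (faddeevSol v k) := fun k hkS =>
    memLmu_faddeevSol hμ (hc k hkS) hC hv hvb (hS hkS) (hk k hkS) (hr k hkS)
  have hsol : ∀ k ∈ S, ∀ p, faddeevSol v k p = v p - faddeevOp v k (faddeevSol v k) p :=
    fun k hkS => faddeevSol_eq hμ (hc k hkS) hC hv hvb (hS hkS) (hk k hkS) (hr k hkS)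
  have hlt : ∀ k ∈ S, ENNReal.ofReal (c k * C) < 1 := fun k hkS => by
    rw [← ENNReal.ofReal_one]
    exact (ENNReal.ofReal_lt_ofReal_iff one_pos).2 (hr k hkS)
  refine ⟨hmem, hsol, fun k hkS U hU hUeq => ?_, fun k hkS U₀ hU₀ => ⟨fun n =>
    memLmu_iterate_faddeevStep hμ (hc k hkS) hv hU₀ (hS hkS) (hk k hkS) n, ?_⟩⟩
  · have hcon := lmuNorm_faddeevStep_sub_le (hc k hkS) hv hvC (hk k hkS) hU (hmem k hkS)
      (hsol k hkS) hμ
    have e : lmuNorm μ (fun p => U p - faddeevSol v k p) =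
        lmuNorm μ (fun p => faddeevStep v k U p - faddeevSol v k p) := by
      refine lmuNorm_congr_ae ?_
      filter_upwards [hUeq] with p hp
      rw [faddeevStep, ← hp]
    rw [← e] at hcon
    have hzero : lmuNorm μ (fun p => U p - faddeevSol v k p) = 0 := by
      by_contra hne
      have hfin := (hU.sub hμ (hmem k hkS)).2.ne
      have := ENNReal.mul_lt_mul_left hne hfin (hlt k hkS)
      rw [one_mul] at this
      exact absurd hcon (not_le.2 this)
    filter_upwards [ae_eq_zero_of_lmuNorm_eq_zero hzero] with p hp
    exact sub_eq_zero.1 hp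
  · have hgeom : ∀ n : ℕ,
        lmuNorm μ (fun p => (faddeevStep v k)^[n] U₀ p - faddeevSol v k p) ≤
          ENNReal.ofReal (c k * C) ^ n * lmuNorm μ (fun p => U₀ p - faddeevSol v k p) := by
      intro n
      induction n with
      | zero => simp
      | succ n ih =>
        rw [Function.iterate_succ_apply', pow_succ', mul_assoc]
        refine (lmuNorm_faddeevStep_sub_le (hc k hkS) hv hvC (hk k hkS)
          (memLmu_iterate_faddeevStep hμ (hc k hkS) hv hU₀ (hS hkS) (hk k hkS) n) (hmem k hkS)
          (hsol k hkS) hμ).trans ?_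
        gcongr
    have hlim := ENNReal.Tendsto.mul_const
      (ENNReal.tendsto_pow_atTop_nhds_zero_of_lt_one (hlt k hkS))
      (Or.inr (hU₀.sub hμ (hmem k hkS)).2.ne)
    rw [zero_mul] at hlim
    exact tendsto_of_tendsto_of_tendsto_of_le_of_le tendsto_const_nhds hlim
      (fun _ => zero_le) hgeom

theorem continuousOn_faddeevSol_sub (hμ : 2 ≤ μ) (hC : 0 ≤ C) (hv : MemLmu μ v)
    (hvb : ∀ᵐ p, ‖v p‖ ≤ C * decay μ p) (hS : S ⊆ sigmaSet)
    (hc : ∀ k ∈ S, 0 ≤ c k) (hk : ∀ k ∈ S, KernelBound μ k (c k)) (hq : q < 1)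
    (hcq : ∀ k ∈ S, c k * C ≤ q) :
    ContinuousOn (fun z : C3 × R3 => faddeevSol v z.1 z.2 - v z.2) (S ×ˢ Set.univ) := by
  rcases S.eq_empty_or_nonempty with rfl | ⟨k₀, hk₀⟩
  · simp
  have hq0 : 0 ≤ q := (mul_nonneg (hc k₀ hk₀) hC).trans (hcq k₀ hk₀)
  have hq' : 0 < 1 - q := by linarith
  have hlim : Tendsto (fun n : ℕ => q * C / (1 - q) * q ^ n) atTop (𝓝 0) := by
    have := (tendsto_pow_atTop_nhds_zero_of_lt_one hq0 hq).const_mul (q * C / (1 - q))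
    rwa [mul_zero] at this
  refine continuousOn_of_uniform_approx_of_continuousOn fun u hu => ?_
  obtain ⟨ε, hε, hεu⟩ := Metric.mem_uniformity_dist.1 hu
  obtain ⟨n, hn⟩ := (hlim.eventually (gt_mem_nhds hε)).exists
  refine ⟨_, continuousOn_iterate_sub hμ hC hv hvb hS hc hk hq hcq n, fun z hz => hεu ?_⟩
  refine lt_of_le_of_lt ?_ hn
  have hzS : z.1 ∈ S := hz.1
  have h0 := mul_nonneg (hc _ hzS) hC
  have hle := hcq _ hzS
  rw [dist_sub_right, dist_comm, dist_eq_norm]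
  refine (norm_iterate_sub_faddeevSol_le hμ (hc _ hzS) hC hv hvb (hS hzS) (hk _ hzS)
    (hle.trans_lt hq) n z.2).trans ?_
  calc c z.1 * C * C * decay μ z.2 * (c z.1 * C) ^ n / (1 - c z.1 * C)
      ≤ q * C * 1 * q ^ n / (1 - q) := by
        have := decay_pos μ z.2
        gcongr
        exact decay_le_one hμ _
    _ = _ := by ring

end Family

theorem log_sq_div_le {τ t : ℝ} (hτ : 0 < τ) (hlog : 2 ≤ Real.log τ) (h : τ ≤ t) :
    Real.log t ^ 2 / t ≤ Real.log τ ^ 2 / τ := by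
  have hτ2 : Real.exp 2 ≤ τ := (Real.le_log_iff_exp_le hτ).1 hlog
  have hanti := Real.log_div_sqrt_antitoneOn (a := τ) hτ2 (b := t) (hτ2.trans h) h
  have ht : 0 < t := hτ.trans_le h
  have hlt : 0 ≤ Real.log t := (by linarith : 0 ≤ Real.log τ).trans (Real.log_le_log hτ h)
  have h2 := pow_le_pow_left₀ (by positivity) hanti 2
  rwa [div_pow, div_pow, Real.sq_sqrt ht.le, Real.sq_sqrt hτ.le] at h2

theorem proposition3p1 (μ : ℝ) (hμ : 2 ≤ μ) :
    -- the integral defining `A(k)U` converges absolutely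
    (∀ vhat U : R3 → ℂ, MemLmu μ vhat → MemLmu μ U → ∀ k ∈ sigmaSet, ∀ p : R3,
      Integrable (faddeevIntegrand vhat k U p) volume) ∧
    ∃ c₁ c₂ : ℝ, 0 < c₁ ∧ 0 < c₂ ∧
    -- the two operator estimates of which `c₁(μ)` and `c₂(μ)` are the constants
    (∀ vhat U : R3 → ℂ, MemLmu μ vhat → MemLmu μ U → ∀ k ∈ sigmaSet,
      lmuNorm μ (faddeevOp vhat k U) ≤ ENNReal.ofReal c₁ * lmuNorm μ vhat * lmuNorm μ U) ∧
    (∀ vhat U : R3 → ℂ, MemLmu μ vhat → MemLmu μ U → ∀ k ∈ sigmaSet,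
      0 < ‖imVec k‖ → 2 ≤ Real.log ‖imVec k‖ →
      lmuNorm μ (faddeevOp vhat k U) ≤
        ENNReal.ofReal (c₂ * (Real.log ‖imVec k‖ ^ 2 / ‖imVec k‖)) *
          lmuNorm μ vhat * lmuNorm μ U) ∧
    ∀ (vhat : R3 → ℂ) (C : ℝ), MemLmu μ vhat → 0 ≤ C → lmuNorm μ vhat ≤ ENNReal.ofReal C →
      -- part (I)
      (c₁ * C < 1 →
        ∃ H : C3 → R3 → ℂ, UniquelySolvedBy μ vhat sigmaSet H ∧
          (∀ k ∈ sigmaSet, lmuNorm μ (H k) ≤ ENNReal.ofReal (C / (1 - c₁ * C))) ∧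
          ContinuousOn (fun q : C3 × R3 => H q.1 q.2 - vhat q.2) (sigmaSet ×ˢ Set.univ) ∧
          (∀ k ∈ sigmaSet, ∀ p : R3,
            ‖H k p - vhat p‖ ≤ c₁ * C ^ 2 / ((1 - c₁ * C) * (1 + ‖p‖) ^ μ))) ∧
      -- part (II)
      (∀ τ : ℝ, 0 < τ → 2 ≤ Real.log τ → eta2 c₂ C τ < 1 →
        ∃ H : C3 → R3 → ℂ, UniquelySolvedBy μ vhat (sigmaSet \ sigmaBelow τ) H ∧
          (∀ k ∈ sigmaSet \ sigmaBelow τ,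
            lmuNorm μ (H k) ≤ ENNReal.ofReal (C / (1 - eta2 c₂ C ‖imVec k‖))) ∧
          ContinuousOn (fun q : C3 × R3 => H q.1 q.2 - vhat q.2)
            ((sigmaSet \ sigmaBelow τ) ×ˢ Set.univ) ∧
          (∀ k ∈ sigmaSet \ sigmaBelow τ, ∀ p : R3,
            ‖H k p - vhat p‖ ≤
              eta2 c₂ C ‖imVec k‖ * C / ((1 - eta2 c₂ C ‖imVec k‖) * (1 + ‖p‖) ^ μ))) := by
  obtain ⟨c, hc, hker, hker'⟩ := exists_kernelBound hμ
  have hdecay : ∀ a b : ℝ, ∀ p : R3, a / b * decay μ p = a / (b * (1 + ‖p‖) ^ μ) := by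
    intro a b p
    rw [decay, Real.rpow_neg (by positivity), ← div_eq_mul_inv, div_div]
  refine ⟨fun v U hv hU k hk p => integrable_faddeevIntegrand hv hU (hker k hk) p,
    c, c, hc, hc, fun v U hv hU k hk => lmuNorm_faddeevOp_le hc.le hv hU (hker k hk),
    fun v U hv hU k hk ht hlog =>
      lmuNorm_faddeevOp_le (by positivity) hv hU (hker' k hk ht hlog),
    fun v C hv hC hvC => ⟨fun hcC => ?_, fun τ hτ hlog hη => ?_⟩⟩
  · have hvb := (lmuNorm_le_ofReal_iff hC).1 hvC
    have hpos : 0 ≤ C / (1 - c * C) := div_nonneg hC (by linarith)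
    refine ⟨faddeevSol v, uniquelySolvedBy_faddeevSol (c := fun _ => c) hμ hC hv hvC subset_rfl
      (fun _ _ => hc.le) hker (fun _ _ => hcC), fun k hk => ?_,
      continuousOn_faddeevSol_sub (c := fun _ => c) hμ hC hv hvb subset_rfl (fun _ _ => hc.le) hker
        hcC (fun _ _ => le_rfl), fun k hk p => ?_⟩
    · exact (lmuNorm_le_ofReal_iff hpos).2
        (ae_norm_faddeevSol_le hμ hc.le hC hv hvb hk (hker k hk) hcC)
    · rw [← hdecay, pow_two, ← mul_assoc]
      exact norm_faddeevSol_sub_le hμ hc.le hC hv hvb hk (hker k hk) hcC p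
  · have hvb := (lmuNorm_le_ofReal_iff hC).1 hvC
    set d : C3 → ℝ := fun k => c * (Real.log ‖imVec k‖ ^ 2 / ‖imVec k‖) with hd
    have hS : sigmaSet \ sigmaBelow τ ⊆ sigmaSet := Set.sdiff_subset
    have hτk : ∀ k ∈ sigmaSet \ sigmaBelow τ, τ ≤ ‖imVec k‖ := fun k hk =>
      not_lt.1 fun hlt => hk.2 ⟨hk.1, hlt⟩
    have hd0 : ∀ k ∈ sigmaSet \ sigmaBelow τ, 0 ≤ d k := fun k _ => by positivity
    have hdker : ∀ k ∈ sigmaSet \ sigmaBelow τ, KernelBound μ k (d k) := fun k hk =>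
      hker' k hk.1 (hτ.trans_le (hτk k hk)) (hlog.trans (Real.log_le_log hτ (hτk k hk)))
    have hdη : ∀ k, eta2 c C ‖imVec k‖ = d k * C := fun k => by
      rw [eta2, hd]
      ring
    have hdq : ∀ k ∈ sigmaSet \ sigmaBelow τ, d k * C ≤ eta2 c C τ := fun k hk => by
      rw [← hdη, eta2, eta2]
      exact mul_le_mul_of_nonneg_left (log_sq_div_le hτ hlog (hτk k hk)) (by positivity)
    have hd1 : ∀ k ∈ sigmaSet \ sigmaBelow τ, d k * C < 1 := fun k hk => (hdq k hk).trans_lt hη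
    refine ⟨faddeevSol v, uniquelySolvedBy_faddeevSol hμ hC hv hvC hS hd0 hdker hd1,
      fun k hk => ?_, continuousOn_faddeevSol_sub hμ hC hv hvb hS hd0 hdker hη hdq,
      fun k hk p => ?_⟩
    · rw [hdη]
      have hpos : 0 ≤ C / (1 - d k * C) := div_nonneg hC (by linarith [hd1 k hk])
      exact (lmuNorm_le_ofReal_iff hpos).2
        (ae_norm_faddeevSol_le hμ (hd0 k hk) hC hv hvb (hS hk) (hdker k hk) (hd1 k hk))
    · rw [← hdecay, hdη]
      exact norm_faddeevSol_sub_le hμ (hd0 k hk) hC hv hvb (hS hk) (hdker k hk) (hd1 k hk) p
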